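/- Let $k$ be a field of characteristic different from $2$. A \emph{2-vector space} is a category in the category of $k$-vector spaces: vector spaces $L_0$ of objects and $L_1$ of morphisms, with linear source, target, identity and composition maps. The \emph{arrow part} of a morphism $f\colon x\to y$ is $\bar f=f-1_x$. Composites are written in diagrammatic order. A \emph{(semistrict) Lie 2-algebra} is a 2-vector space $L$ together with a functor $[\cdot,\cdot]\colon L\times L\to L$ that is bilinear and skew-symmetric on objects and on morphisms, and a natural isomorphism $J_{x,y,z}\colon[[x,y],z]\to[x,[y,z]]+[[x,z],y]$ that is trilinear in the objects $x,y,z$ and whose arrow part is completely antisymmetric, such that for all objects $w,x,y,z$ $$J_{[w,x],y,z}\,([J_{w,x,z},y]+1)\,(J_{w,[x,z],y}+J_{[w,z],x,y}+J_{w,x,[y,z]})$$ $$=[J_{w,x,y},z]\,(J_{[w,y],x,z}+J_{w,[x,y],z})\,([J_{w,y,z},x]+1)\,([w,J_{x,y,z}]+1),$$ where an object inside a bracket of morphisms stands for its identity morphism and each $1$ is the only identity morphism for which the composite makes sense. A \emph{homomorphism} $F\colon L\to L'$ is a linear functor $(F_0,F_1)$ together with a bilinear skew-symmetric natural transformation $F_2(x,y)\colon[F_0x,F_0y]\to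 F_0[x,y]$ such that $$J_{F_0x,F_0y,F_0z}\,\bigl([1,F_2(y,z)]+[F_2(x,z),1]\bigr)\,\bigl(F_2(x,[y,z])+F_2([x,z],y)\bigr)=[F_2(x,y),1]\,F_2([x,y],z)\,F_1(J_{x,y,z}).$$ The composite $FG$ of $F\colon L\to L'$ and $G\colon L'\to L''$ is the composite functor with $(FG)_2(x,y)=G_2(F_0x,F_0y)\,G_1(F_2(x,y))$. A \emph{2-homomorphism} $\theta\colon F\Rightarrow G$ is a linear natural transformation such that $[\theta_x,\theta_y]\,G_2(x,y)=F_2(x,y)\,\theta_{[x,y]}$. With the usual compositions of natural transformations these form a strict 2-category $\mathrm{Lie2Alg}$. Two Lie 2-algebras $L,L'$ are \emph{equivalent} if they are equivalent objects of it: there are homomorphisms $L\to L'$ and $L'\to L$ whose two composites are isomorphic, by invertible 2-homomorphisms, to the identity homomorphisms. Consider quadruples $(\mathfrak g,V,\rho,c)$ of a Lie algebra $\mathfrak g$ over $k$, a $k$-vector space $V$, a representation $\rho$ of $\mathfrak g$ on $V$, and a class $c\in H^3(\mathfrak g,V)$ in Lie algebra cohomology (cocycles modulo coboundaries for the usual coboundary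 operator on alternating cochains). An isomorphism $(\mathfrak g,V,\rho,c)\to(\mathfrak g',V',\rho',c')$ is a Lie algebra isomorphism $\varphi\colon\mathfrak g\to\mathfrak g'$ together with a linear isomorphism $\psi\colon V\to V'$ such that $\psi(\rho(x)v)=\rho'(\varphi(x))\psi(v)$ for all $x,v$ and the induced map $H^3(\mathfrak g,V)\to H^3(\mathfrak g',V')$, $[\omega]\mapsto[\psi\circ\omega\circ(\varphi^{-1}\times\varphi^{-1}\times\varphi^{-1})]$, sends $c$ to $c'$. \textbf{Theorem.} There is a bijection from the set of equivalence classes of Lie 2-algebras over $k$ to the set of isomorphism classes of such quadruples. It sends, for every $(\mathfrak g,V,\rho)$ and every 3-cocycle $\omega$ on $\mathfrak g$ with values in $V$, the class of the following skeletal Lie 2-algebra to the class of $(\mathfrak g,V,\rho,[\omega])$: its space of objects is $\mathfrak g$ and its space of morphisms is $\mathfrak g\oplus V$, where $(x,f)$ is a morphism $x\to x$ with arrow part $f$; its bracket is that of $\mathfrak g$ on objects and $[(x,f),(y,h)]=([x,y],\rho(x)h-\rho(y)f)$ on morphisms; and its Jacobiator is $J_{x,y,z}=([[x,y],z],\omega(x,y,z))$.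 -/

import Mathlib

open CategoryTheory

universe w u

namespace LieTwo

/-! ### Categories in `Vect`: 2-vector spaces -/

/-- A 2-vector space over `k`: a category in the category of `k`-vector spaces. Composition is a
linear map on the pullback `{(f, g) | t f = s g}` and is written in diagrammatic order. -/
structure TwoVect (k : Type w) [Field k] where
  obj : Type u
  mor : Type u
  [objGroup : AddCommGroup obj]
  [objModule : Module k obj]
  [morGroup : AddCommGroup mor]
  [morModule : Module k mor]
  src : mor →ₗ[k] obj
  tgt : mor →ₗ[k] obj
  ident : obj →ₗ[k] mor
  comp : LinearMap.eqLocus (tgt ∘ₗ LinearMap.fst k mor mor) (src ∘ₗ LinearMap.snd k mor mor) →ₗ[k]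
    mor
  src_ident : ∀ x, src (ident x) = x
  tgt_ident : ∀ x, tgt (ident x) = x
  src_comp : ∀ (f g : mor) (h : tgt f = src g), src (comp ⟨(f, g), h⟩) = src f
  tgt_comp : ∀ (f g : mor) (h : tgt f = src g), tgt (comp ⟨(f, g), h⟩) = tgt g
  assoc : ∀ (f g h : mor) (hfg : tgt f = src g) (hgh : tgt g = src h),
    comp ⟨(comp ⟨(f, g), hfg⟩, h), (tgt_comp f g hfg).trans hgh⟩ =
      comp ⟨(f, comp ⟨(g, h), hgh⟩), hfg.trans (src_comp g h hgh).symm⟩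
  ident_comp : ∀ f : mor, comp ⟨(ident (src f), f), tgt_ident (src f)⟩ = f
  comp_ident : ∀ f : mor, comp ⟨(f, ident (tgt f)), (src_ident (tgt f)).symm⟩ = f

attribute [instance] TwoVect.objGroup TwoVect.objModule TwoVect.morGroup TwoVect.morModule
attribute [simp] TwoVect.src_ident TwoVect.tgt_ident

variable {k : Type w} [Field k]

namespace TwoVect

variable (V : TwoVect.{w, u} k)

/-- The composite `f g` of `f : x → y` and `g : y → z`. -/
def cmp (f g : V.mor) (h : V.tgt f = V.src g) : V.mor := V.comp ⟨(f, g), h⟩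

@[simp] lemma src_cmp (f g : V.mor) (h : V.tgt f = V.src g) : V.src (V.cmp f g h) = V.src f :=
  V.src_comp f g h

@[simp] lemma tgt_cmp (f g : V.mor) (h : V.tgt f = V.src g) : V.tgt (V.cmp f g h) = V.tgt g :=
  V.tgt_comp f g h

/-- Composition is determined by the linear structure. -/
lemma cmp_eq (f g : V.mor) (h : V.tgt f = V.src g) :
    V.cmp f g h = f + g - V.ident (V.src g) := by
  have h0 : V.tgt (0 : V.mor) = V.src (g - V.ident (V.src g)) := by simp
  have h1 : V.cmp f g h = V.comp ⟨(f, V.ident (V.tgt f)), (V.src_ident _).symm⟩ +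
      V.comp ⟨(0, g - V.ident (V.src g)), h0⟩ := by
    rw [← map_add]
    unfold cmp
    congr 1
    ext <;> simp [h]
  have h2 := V.ident_comp (g - V.ident (V.src g))
  have h3 : V.comp ⟨(0, g - V.ident (V.src g)), h0⟩ = g - V.ident (V.src g) := by
    conv_rhs => rw [← h2]
    congr 3
    simp
  rw [h1, V.comp_ident, h3]
  abel

/-- The arrow part `f - 1_{s f}` of a morphism `f`. -/
def arrow (f : V.mor) : V.mor := f - V.ident (V.src f)

/-- A morphism is invertible if it has a two-sided inverse. -/
def IsInvertible (f : V.mor) : Prop :=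
  ∃ (g : V.mor) (h : V.tgt f = V.src g) (h' : V.tgt g = V.src f),
    V.cmp f g h = V.ident (V.src f) ∧ V.cmp g f h' = V.ident (V.tgt f)

lemma isInvertible (f : V.mor) : V.IsInvertible f := by
  refine ⟨V.ident (V.src f) + V.ident (V.tgt f) - f, by simp, by simp, ?_, ?_⟩
  · rw [cmp_eq]; simp
  · rw [cmp_eq]; simp

end TwoVect

/-- A linear functor between 2-vector spaces: a functor in `Vect`. -/
structure LinearFunctor (V W : TwoVect.{w, u} k) where
  onObj : V.obj →ₗ[k] W.obj
  onMor : V.mor →ₗ[k] W.mor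
  src_map : ∀ f, W.src (onMor f) = onObj (V.src f)
  tgt_map : ∀ f, W.tgt (onMor f) = onObj (V.tgt f)
  map_ident : ∀ x, onMor (V.ident x) = W.ident (onObj x)
  map_cmp : ∀ f g (h : V.tgt f = V.src g),
    onMor (V.cmp f g h) = W.cmp (onMor f) (onMor g) (by rw [tgt_map, src_map, h])

attribute [simp] LinearFunctor.src_map LinearFunctor.tgt_map LinearFunctor.map_ident

/-- A linear natural transformation: a natural transformation in `Vect`. -/
structure LinearNatTrans {V W : TwoVect.{w, u} k} (F G : LinearFunctor V W) where
  app : V.obj →ₗ[k] W.mor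
  src_app : ∀ x, W.src (app x) = F.onObj x
  tgt_app : ∀ x, W.tgt (app x) = G.onObj x
  naturality : ∀ f : V.mor,
    W.cmp (F.onMor f) (app (V.tgt f)) (by rw [F.tgt_map, src_app]) =
      W.cmp (app (V.src f)) (G.onMor f) (by rw [G.src_map, tgt_app])

attribute [simp] LinearNatTrans.src_app LinearNatTrans.tgt_app

/-- A bilinear functor `V × V' → W`: a functor out of the product category that is bilinear on
objects and on morphisms. -/
structure BilinearFunctor (V V' W : TwoVect.{w, u} k) where
  onObj : V.obj →ₗ[k] V'.obj →ₗ[k] W.obj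
  onMor : V.mor →ₗ[k] V'.mor →ₗ[k] W.mor
  src_map : ∀ f g, W.src (onMor f g) = onObj (V.src f) (V'.src g)
  tgt_map : ∀ f g, W.tgt (onMor f g) = onObj (V.tgt f) (V'.tgt g)
  map_ident : ∀ x y, onMor (V.ident x) (V'.ident y) = W.ident (onObj x y)
  map_cmp : ∀ f f' g g' (h : V.tgt f = V.src f') (h' : V'.tgt g = V'.src g'),
    onMor (V.cmp f f' h) (V'.cmp g g' h') =
      W.cmp (onMor f g) (onMor f' g') (by rw [tgt_map, src_map, h, h'])

attribute [simp] BilinearFunctor.src_map BilinearFunctor.tgt_map BilinearFunctor.map_ident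

/-- Skew-symmetry on objects and on morphisms. -/
def BilinearFunctor.IsSkew {V W : TwoVect.{w, u} k} (B : BilinearFunctor V V W) : Prop :=
  (∀ x y, B.onObj x y = -B.onObj y x) ∧ (∀ f g, B.onMor f g = -B.onMor g f)

/-! ### Semistrict Lie 2-algebras -/

/-- A completely antisymmetric trilinear natural isomorphism
`J_{x,y,z} : [[x,y],z] ⟶ [x,[y,z]] + [[x,z],y]` for a bracket `B`. -/
structure Jacobiator {V : TwoVect.{w, u} k} (B : BilinearFunctor V V V) where
  app : V.obj →ₗ[k] V.obj →ₗ[k] V.obj →ₗ[k] V.mor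
  src_app : ∀ x y z, V.src (app x y z) = B.onObj (B.onObj x y) z
  tgt_app : ∀ x y z,
    V.tgt (app x y z) = B.onObj x (B.onObj y z) + B.onObj (B.onObj x z) y
  naturality : ∀ f g h : V.mor,
    V.cmp (B.onMor (B.onMor f g) h) (app (V.tgt f) (V.tgt g) (V.tgt h))
        (by simp only [B.tgt_map, src_app]) =
      V.cmp (app (V.src f) (V.src g) (V.src h))
        (B.onMor f (B.onMor g h) + B.onMor (B.onMor f h) g)
        (by simp only [map_add, B.src_map, tgt_app])
  invertible : ∀ x y z, V.IsInvertible (app x y z)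
  arrow_swap₁₂ : ∀ x y z, V.arrow (app y x z) = -V.arrow (app x y z)
  arrow_swap₂₃ : ∀ x y z, V.arrow (app x z y) = -V.arrow (app x y z)

attribute [simp] Jacobiator.src_app Jacobiator.tgt_app

namespace Jacobiator

variable {V : TwoVect.{w, u} k} {B : BilinearFunctor V V V} (J : Jacobiator B)

/-- The composite
`J_{[w,x],y,z} ([J_{w,x,z},y] + 1) (J_{w,[x,z],y} + J_{[w,z],x,y} + J_{w,x,[y,z]})`,
where `1` is the identity of `[[w,x],[y,z]]`. -/
def leftPath (w x y z : V.obj) : V.mor :=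
  V.cmp
    (V.cmp (J.app (B.onObj w x) y z)
      (B.onMor (J.app w x z) (V.ident y) + V.ident (B.onObj (B.onObj w x) (B.onObj y z)))
      (by simp; abel))
    (J.app w (B.onObj x z) y + J.app (B.onObj w z) x y + J.app w x (B.onObj y z))
    (by simp [add_comm])

/-- The composite
`[J_{w,x,y},z] (J_{[w,y],x,z} + J_{w,[x,y],z}) ([J_{w,y,z},x] + 1) ([w,J_{x,y,z}] + 1)`,
where the identities are those of the terms that are not rebracketed. -/
def rightPath (w x y z : V.obj) : V.mor :=
  V.cmp
    (V.cmp
      (V.cmp (B.onMor (J.app w x y) (V.ident z))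
        (J.app (B.onObj w y) x z + J.app w (B.onObj x y) z)
        (by simp; abel))
      (B.onMor (J.app w y z) (V.ident x) +
        V.ident (B.onObj (B.onObj w y) (B.onObj x z) + B.onObj w (B.onObj (B.onObj x y) z) +
          B.onObj (B.onObj w z) (B.onObj x y)))
      (by simp; abel))
    (B.onMor (V.ident w) (J.app x y z) +
      V.ident (B.onObj (B.onObj (B.onObj w z) y) x + B.onObj (B.onObj w (B.onObj y z)) x +
        B.onObj (B.onObj w y) (B.onObj x z) + B.onObj (B.onObj w z) (B.onObj x y)))
    (by simp; abel)

end Jacobiator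

/-- A semistrict Lie 2-algebra over `k`. -/
structure Lie2Alg (k : Type w) [Field k] where
  carrier : TwoVect.{w, u} k
  bracket : BilinearFunctor carrier carrier carrier
  bracket_skew : bracket.IsSkew
  jac : Jacobiator bracket
  jacobiator_identity : ∀ w x y z, jac.leftPath w x y z = jac.rightPath w x y z

namespace Lie2Alg

/-- The data of a homomorphism of Lie 2-algebras, without the coherence law: a linear functor `F`
and a skew-symmetric bilinear natural transformation `F₂(x,y) : [F₀ x, F₀ y] ⟶ F₀ [x,y]`. -/
structure PreHom (L L' : Lie2Alg.{w, u} k) extends LinearFunctor L.carrier L'.carrier where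
  two : L.carrier.obj →ₗ[k] L.carrier.obj →ₗ[k] L'.carrier.mor
  src_two : ∀ x y, L'.carrier.src (two x y) = L'.bracket.onObj (onObj x) (onObj y)
  tgt_two : ∀ x y, L'.carrier.tgt (two x y) = onObj (L.bracket.onObj x y)
  two_naturality : ∀ f g : L.carrier.mor,
    L'.carrier.cmp (L'.bracket.onMor (onMor f) (onMor g))
        (two (L.carrier.tgt f) (L.carrier.tgt g))
        (by simp only [BilinearFunctor.tgt_map, src_two, tgt_map]) =
      L'.carrier.cmp (two (L.carrier.src f) (L.carrier.src g)) (onMor (L.bracket.onMor f g))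
        (by simp only [BilinearFunctor.src_map, tgt_two, src_map])
  two_skew : ∀ x y, two x y = -two y x

attribute [simp] PreHom.src_two PreHom.tgt_two

namespace PreHom

variable {L L' : Lie2Alg.{w, u} k} (F : PreHom L L')

/-- The composite of `J_{F₀ x, F₀ y, F₀ z}`, `[1, F₂] + [F₂, 1]` and `F₂ + F₂`. -/
def upperPath (x y z : L.carrier.obj) : L'.carrier.mor :=
  L'.carrier.cmp
    (L'.carrier.cmp (L'.jac.app (F.onObj x) (F.onObj y) (F.onObj z))
      (L'.bracket.onMor (L'.carrier.ident (F.onObj x)) (F.two y z) +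
        L'.bracket.onMor (F.two x z) (L'.carrier.ident (F.onObj y)))
      (by simp))
    (F.two x (L.bracket.onObj y z) + F.two (L.bracket.onObj x z) y)
    (by simp)

/-- The composite of `[F₂, 1]`, `F₂` and `F₁(J_{x,y,z})`. -/
def lowerPath (x y z : L.carrier.obj) : L'.carrier.mor :=
  L'.carrier.cmp
    (L'.carrier.cmp (L'.bracket.onMor (F.two x y) (L'.carrier.ident (F.onObj z)))
      (F.two (L.bracket.onObj x y) z)
      (by simp))
    (F.onMor (L.jac.app x y z))
    (by simp)

end PreHom

/-- A homomorphism of Lie 2-algebras. -/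
structure Hom (L L' : Lie2Alg.{w, u} k) extends PreHom L L' where
  coherence : ∀ x y z, toPreHom.upperPath x y z = toPreHom.lowerPath x y z

/-- A 2-homomorphism between homomorphisms of Lie 2-algebras. -/
structure Hom₂ {L L' : Lie2Alg.{w, u} k} (F G : Hom L L') extends
    LinearNatTrans F.toLinearFunctor G.toLinearFunctor where
  square : ∀ x y,
    L'.carrier.cmp (L'.bracket.onMor (app x) (app y)) (G.two x y)
        (by simp only [BilinearFunctor.tgt_map, PreHom.src_two, tgt_app]) =
      L'.carrier.cmp (F.two x y) (app (L.bracket.onObj x y))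
        (by simp only [PreHom.tgt_two, src_app])

lemma Hom₂.ext_app {L L' : Lie2Alg.{w, u} k} {F G : Hom L L'} {η θ : Hom₂ F G}
    (h : ∀ x, η.app x = θ.app x) : η = θ := by
  obtain ⟨⟨a, _, _, _⟩, _⟩ := η
  obtain ⟨⟨b, _, _, _⟩, _⟩ := θ
  have : a = b := LinearMap.ext h
  subst this
  rfl

/-! ### The 2-category of Lie 2-algebras -/

/-- The identity homomorphism, with `(1_L)₂` an identity transformation. -/
def Hom.id (L : Lie2Alg.{w, u} k) : Hom L L where
  onObj := LinearMap.id
  onMor := LinearMap.id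
  src_map _ := rfl
  tgt_map _ := rfl
  map_ident _ := rfl
  map_cmp _ _ _ := rfl
  two := L.bracket.onObj.compr₂ L.carrier.ident
  src_two x y := by simp
  tgt_two x y := by simp
  two_naturality f g := by simp [TwoVect.cmp_eq]
  two_skew x y := by
    simp only [LinearMap.compr₂_apply]
    rw [L.bracket_skew.1 x y, map_neg]
  coherence x y z := by
    simp [PreHom.upperPath, PreHom.lowerPath, TwoVect.cmp_eq]

/-- The composite `F G`, with `(FG)₂(x,y)` the composite of `G₂(F₀ x, F₀ y)` and `G₁(F₂(x,y))`. -/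
def PreHom.comp {L L' L'' : Lie2Alg.{w, u} k} (F : PreHom L L') (G : PreHom L' L'') :
    PreHom L L'' where
  onObj := G.onObj ∘ₗ F.onObj
  onMor := G.onMor ∘ₗ F.onMor
  src_map f := by simp
  tgt_map f := by simp
  map_ident x := by simp
  map_cmp f g h := by simp [F.map_cmp f g h, G.map_cmp]
  two := LinearMap.mk₂ k
    (fun x y => L''.carrier.cmp (G.two (F.onObj x) (F.onObj y)) (G.onMor (F.two x y)) (by simp))
    (fun x x' y => by simp [TwoVect.cmp_eq]; abel)
    (fun c x y => by simp [TwoVect.cmp_eq, smul_add, smul_sub])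
    (fun x y y' => by simp [TwoVect.cmp_eq]; abel)
    (fun c x y => by simp [TwoVect.cmp_eq, smul_add, smul_sub])
  src_two x y := by simp
  tgt_two x y := by simp
  two_naturality f g := by
    have h1 := G.two_naturality (F.onMor f) (F.onMor g)
    have h2 := congrArg G.onMor (F.two_naturality f g)
    simp [TwoVect.cmp_eq] at h1 h2 ⊢
    grind
  two_skew x y := by
    have h1 := G.two_skew (F.onObj x) (F.onObj y)
    have h2 := congrArg G.onMor (F.two_skew x y)
    have h3 := congrArg L''.carrier.ident
      (congrArg G.onObj (L'.bracket_skew.1 (F.onObj x) (F.onObj y)))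
    simp [TwoVect.cmp_eq] at h1 h2 h3 ⊢
    grind

@[simp] lemma PreHom.comp_two {L L' L'' : Lie2Alg.{w, u} k} (F : PreHom L L') (G : PreHom L' L'')
    (x y : L.carrier.obj) : (F.comp G).two x y =
      L''.carrier.cmp (G.two (F.onObj x) (F.onObj y)) (G.onMor (F.two x y)) (by simp) := rfl

/-- The composite of two homomorphisms. -/
def Hom.comp {L L' L'' : Lie2Alg.{w, u} k} (F : Hom L L') (G : Hom L' L'') : Hom L L'' where
  toPreHom := F.toPreHom.comp G.toPreHom
  coherence x y z := by
    have h1 := G.coherence (F.onObj x) (F.onObj y) (F.onObj z)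
    have h2 := congrArg G.onMor (F.coherence x y z)
    have n1 := G.two_naturality (F.two x y) (L'.carrier.ident (F.onObj z))
    have n2 := G.two_naturality (L'.carrier.ident (F.onObj x)) (F.two y z)
    have n3 := G.two_naturality (F.two x z) (L'.carrier.ident (F.onObj y))
    simp [PreHom.upperPath, PreHom.lowerPath, TwoVect.cmp_eq, PreHom.comp] at h1 h2 n1 n2 n3 ⊢
    grind

/-- The identity 2-homomorphism. -/
def Hom₂.id {L L' : Lie2Alg.{w, u} k} (F : Hom L L') : Hom₂ F F where
  app := L'.carrier.ident ∘ₗ F.onObj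
  src_app x := by simp
  tgt_app x := by simp
  naturality f := by simp [TwoVect.cmp_eq]
  square x y := by simp [TwoVect.cmp_eq]

/-- Vertical composition: `(η θ)_x` is the composite of `η_x` and `θ_x`. -/
def Hom₂.comp {L L' : Lie2Alg.{w, u} k} {F G H : Hom L L'} (η : Hom₂ F G) (θ : Hom₂ G H) :
    Hom₂ F H where
  app :=
    { toFun := fun x => L'.carrier.cmp (η.app x) (θ.app x) (by simp)
      map_add' := fun x y => by simp [TwoVect.cmp_eq]; abel
      map_smul' := fun c x => by simp [TwoVect.cmp_eq, smul_add, smul_sub] }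
  src_app x := by simp
  tgt_app x := by simp
  naturality f := by
    have h1 := η.naturality f
    have h2 := θ.naturality f
    simp [TwoVect.cmp_eq] at h1 h2 ⊢
    grind
  square x y := by
    have h1 := η.square x y
    have h2 := θ.square x y
    have h3 := L'.bracket.map_cmp (η.app x) (θ.app x) (η.app y) (θ.app y) (by simp) (by simp)
    simp [TwoVect.cmp_eq] at h1 h2 h3 ⊢
    grind

/-- Whiskering `F ◁ θ`: its component at `x` is `θ_{F₀ x}`. -/
def Hom₂.whiskerLeft {L L' L'' : Lie2Alg.{w, u} k} (F : Hom L L') {G H : Hom L' L''}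
    (θ : Hom₂ G H) : Hom₂ (F.comp G) (F.comp H) where
  app := θ.app ∘ₗ F.onObj
  src_app x := by simp [Hom.comp, PreHom.comp]
  tgt_app x := by simp [Hom.comp, PreHom.comp]
  naturality f := by
    have h1 := θ.naturality (F.onMor f)
    simp [TwoVect.cmp_eq, Hom.comp, PreHom.comp] at h1 ⊢
    grind
  square x y := by
    have h1 := θ.square (F.onObj x) (F.onObj y)
    have h2 := θ.naturality (F.two x y)
    simp [TwoVect.cmp_eq, Hom.comp, PreHom.comp] at h1 h2 ⊢
    grind

/-- Whiskering `θ ▷ H`: its component at `x` is `H₁(θ_x)`. -/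
def Hom₂.whiskerRight {L L' L'' : Lie2Alg.{w, u} k} {F G : Hom L L'} (θ : Hom₂ F G)
    (H : Hom L' L'') : Hom₂ (F.comp H) (G.comp H) where
  app := H.onMor ∘ₗ θ.app
  src_app x := by simp [Hom.comp, PreHom.comp]
  tgt_app x := by simp [Hom.comp, PreHom.comp]
  naturality f := by
    have h1 := congrArg H.onMor (θ.naturality f)
    simp [TwoVect.cmp_eq, Hom.comp, PreHom.comp] at h1 ⊢
    grind
  square x y := by
    have h1 := congrArg H.onMor (θ.square x y)
    have h2 := H.two_naturality (θ.app x) (θ.app y)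
    simp [TwoVect.cmp_eq, Hom.comp, PreHom.comp] at h1 h2 ⊢
    grind

instance : CategoryStruct (Lie2Alg.{w, u} k) where
  Hom := Hom
  id := Hom.id
  comp := Hom.comp

lemma Hom.ext_app {L L' : Lie2Alg.{w, u} k} {F G : Hom L L'}
    (h₀ : F.onObj = G.onObj) (h₁ : F.onMor = G.onMor) (h₂ : F.two = G.two) : F = G := by
  obtain ⟨⟨⟨_, _, _, _, _, _⟩, _, _, _, _, _⟩, _⟩ := F
  obtain ⟨⟨⟨_, _, _, _, _, _⟩, _, _, _, _, _⟩, _⟩ := G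
  subst h₀
  subst h₁
  subst h₂
  rfl

instance homCategory (L L' : Lie2Alg.{w, u} k) : Category (L ⟶ L') where
  Hom F G := Hom₂ F G
  id F := Hom₂.id F
  comp η θ := Hom₂.comp η θ
  id_comp η := Hom₂.ext_app fun x => by simp [Hom₂.id, Hom₂.comp, TwoVect.cmp_eq]
  comp_id η := Hom₂.ext_app fun x => by simp [Hom₂.id, Hom₂.comp, TwoVect.cmp_eq]
  assoc η θ ι := Hom₂.ext_app fun x => by simp [Hom₂.comp, TwoVect.cmp_eq]; abel

lemma Hom.id_comp_eq {L L' : Lie2Alg.{w, u} k} (F : L ⟶ L') : 𝟙 L ≫ F = F :=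
  Hom.ext_app (F := Hom.comp (Hom.id L) F) (G := F) rfl rfl <| LinearMap.ext₂ fun x y => by
    simp [Hom.comp, Hom.id, TwoVect.cmp_eq]

lemma Hom.comp_id_eq {L L' : Lie2Alg.{w, u} k} (F : L ⟶ L') : F ≫ 𝟙 L' = F :=
  Hom.ext_app (F := Hom.comp F (Hom.id L')) (G := F) rfl rfl <| LinearMap.ext₂ fun x y => by
    simp [Hom.comp, Hom.id, TwoVect.cmp_eq]

lemma Hom.assoc_eq {L₁ L₂ L₃ L₄ : Lie2Alg.{w, u} k} (F : L₁ ⟶ L₂) (G : L₂ ⟶ L₃)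
    (H : L₃ ⟶ L₄) : (F ≫ G) ≫ H = F ≫ G ≫ H :=
  Hom.ext_app (F := Hom.comp (Hom.comp F G) H) (G := Hom.comp F (Hom.comp G H)) rfl rfl <|
    LinearMap.ext₂ fun x y => by
      simp [Hom.comp, PreHom.comp, TwoVect.cmp_eq]
      abel

/-- The component of a 2-homomorphism at an object. -/
def component {L L' : Lie2Alg.{w, u} k} {F G : L ⟶ L'} (η : F ⟶ G) (x : L.carrier.obj) :
    L'.carrier.mor :=
  (Hom₂.toLinearNatTrans η).app x

/-- The effect of a homomorphism on objects. -/
def objMap {L L' : Lie2Alg.{w, u} k} (F : L ⟶ L') (x : L.carrier.obj) : L'.carrier.obj :=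
  (Hom.toPreHom F).onObj x

/-- The effect of a homomorphism on morphisms. -/
def morMap {L L' : Lie2Alg.{w, u} k} (F : L ⟶ L') (f : L.carrier.mor) : L'.carrier.mor :=
  (Hom.toPreHom F).onMor f

section components

variable {L₁ L₂ L₃ : Lie2Alg.{w, u} k}

lemma component_ext {F G : L₁ ⟶ L₂} {η θ : F ⟶ G} (h : ∀ x, component η x = component θ x) :
    η = θ :=
  Hom₂.ext_app h

@[simp] lemma component_eqToHom {F G : L₁ ⟶ L₂} (h : F = G) (x : L₁.carrier.obj) :
    component (eqToHom h) x = L₂.carrier.ident (objMap F x) := by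
  subst h
  rfl

@[simp] lemma component_id (F : L₁ ⟶ L₂) (x : L₁.carrier.obj) :
    component (𝟙 F) x = L₂.carrier.ident (objMap F x) := rfl

@[simp] lemma component_comp {F G H : L₁ ⟶ L₂} (η : F ⟶ G) (θ : G ⟶ H) (x : L₁.carrier.obj) :
    component (η ≫ θ) x = component η x + component θ x - L₂.carrier.ident (objMap G x) := by
  change L₂.carrier.cmp _ _ _ = _
  rw [TwoVect.cmp_eq, LinearNatTrans.src_app]
  rfl

@[simp] lemma objMap_id (x : L₁.carrier.obj) : objMap (𝟙 L₁) x = x := rfl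

@[simp] lemma morMap_id (f : L₁.carrier.mor) : morMap (𝟙 L₁) f = f := rfl

@[simp] lemma objMap_comp (F : L₁ ⟶ L₂) (G : L₂ ⟶ L₃) (x : L₁.carrier.obj) :
    objMap (F ≫ G) x = objMap G (objMap F x) := rfl

@[simp] lemma morMap_comp (F : L₁ ⟶ L₂) (G : L₂ ⟶ L₃) (f : L₁.carrier.mor) :
    morMap (F ≫ G) f = morMap G (morMap F f) := rfl

@[simp] lemma morMap_ident (F : L₁ ⟶ L₂) (x : L₁.carrier.obj) :
    morMap F (L₁.carrier.ident x) = L₂.carrier.ident (objMap F x) :=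
  (Hom.toPreHom F).map_ident x

@[simp] lemma morMap_add (F : L₁ ⟶ L₂) (f g : L₁.carrier.mor) :
    morMap F (f + g) = morMap F f + morMap F g :=
  map_add ((Hom.toPreHom F).onMor) f g

@[simp] lemma morMap_sub (F : L₁ ⟶ L₂) (f g : L₁.carrier.mor) :
    morMap F (f - g) = morMap F f - morMap F g :=
  map_sub ((Hom.toPreHom F).onMor) f g

lemma component_naturality {F G : L₁ ⟶ L₂} (η : F ⟶ G) (f : L₁.carrier.mor) :
    morMap F f + component η (L₁.carrier.tgt f) -
        L₂.carrier.ident (objMap F (L₁.carrier.tgt f)) =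
      component η (L₁.carrier.src f) + morMap G f -
        L₂.carrier.ident (objMap G (L₁.carrier.src f)) := by
  have h := (Hom₂.toLinearNatTrans η).naturality f
  simp only [TwoVect.cmp_eq, LinearNatTrans.src_app, LinearFunctor.src_map] at h
  exact h

lemma src_component {F G : L₁ ⟶ L₂} (η : F ⟶ G) (x : L₁.carrier.obj) :
    L₂.carrier.src (component η x) = objMap F x :=
  (Hom₂.toLinearNatTrans η).src_app x

lemma tgt_component {F G : L₁ ⟶ L₂} (η : F ⟶ G) (x : L₁.carrier.obj) :
    L₂.carrier.tgt (component η x) = objMap G x :=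
  (Hom₂.toLinearNatTrans η).tgt_app x

/-- Left whiskering with the composition of the 2-category. -/
def whiskerL (F : L₁ ⟶ L₂) {G H : L₂ ⟶ L₃} (θ : G ⟶ H) : F ≫ G ⟶ F ≫ H :=
  Hom₂.whiskerLeft F θ

/-- Right whiskering with the composition of the 2-category. -/
def whiskerR {F G : L₁ ⟶ L₂} (θ : F ⟶ G) (H : L₂ ⟶ L₃) : F ≫ H ⟶ G ≫ H :=
  Hom₂.whiskerRight θ H

@[simp] lemma component_whiskerL (F : L₁ ⟶ L₂) {G H : L₂ ⟶ L₃} (θ : G ⟶ H) (x : L₁.carrier.obj) :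
    component (whiskerL F θ) x = component θ (objMap F x) := rfl

@[simp] lemma component_whiskerR {F G : L₁ ⟶ L₂} (θ : F ⟶ G) (H : L₂ ⟶ L₃) (x : L₁.carrier.obj) :
    component (whiskerR θ H) x = morMap H (component θ x) := rfl

end components

/-- The strict 2-category of Lie 2-algebras, homomorphisms and 2-homomorphisms. -/
instance : Bicategory (Lie2Alg.{w, u} k) where
  homCategory := homCategory
  whiskerLeft F _ _ θ := whiskerL F θ
  whiskerRight θ H := whiskerR θ H
  associator F G H := eqToIso (Hom.assoc_eq F G H)
  leftUnitor F := eqToIso (Hom.id_comp_eq F)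
  rightUnitor F := eqToIso (Hom.comp_id_eq F)
  whiskerLeft_id F G := component_ext fun x => by simp
  whiskerLeft_comp F _ _ _ η θ := component_ext fun x => by simp
  id_whiskerLeft η := component_ext fun x => by simp
  comp_whiskerLeft F G _ _ η := component_ext fun x => by simp
  id_whiskerRight F G := component_ext fun x => by simp
  comp_whiskerRight η θ I := component_ext fun x => by simp
  whiskerRight_id η := component_ext fun x => by simp
  whiskerRight_comp η G H := component_ext fun x => by simp
  whisker_assoc F _ _ η H := component_ext fun x => by simp
  whisker_exchange η θ := component_ext fun x => by
    simp
    have h := component_naturality θ (component η x)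
    rw [src_component, tgt_component] at h
    rw [h]
  pentagon F G H I := component_ext fun x => by simp
  triangle F G := component_ext fun x => by simp

instance : Bicategory.Strict (Lie2Alg.{w, u} k) where
  id_comp := Hom.id_comp_eq
  comp_id := Hom.comp_id_eq
  assoc := Hom.assoc_eq

open scoped Bicategory in
/-- Equivalence of objects in a bicategory: there are 1-morphisms in both directions whose
composites are isomorphic to identities. -/
def ObjEquiv {B : Type*} [Bicategory B] (a b : B) : Prop :=
  ∃ (f : a ⟶ b) (g : b ⟶ a), Nonempty (f ≫ g ≅ 𝟙 a) ∧ Nonempty (g ≫ f ≅ 𝟙 b)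

open scoped Bicategory in
/-- Equivalence of Lie 2-algebras as objects of the 2-category `Lie2Alg`. -/
instance equivSetoid (k : Type w) [Field k] : Setoid (Lie2Alg.{w, u} k) where
  r := ObjEquiv
  iseqv :=
    { refl := fun a => ⟨𝟙 a, 𝟙 a, ⟨λ_ _⟩, ⟨λ_ _⟩⟩
      symm := fun ⟨f, g, h, h'⟩ => ⟨g, f, h', h⟩
      trans := by
        rintro a b c ⟨f, g, ⟨e₁⟩, ⟨e₂⟩⟩ ⟨f', g', ⟨e₁'⟩, ⟨e₂'⟩⟩
        refine ⟨f ≫ f', g' ≫ g, ⟨?_⟩, ⟨?_⟩⟩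
        · exact α_ f f' (g' ≫ g) ≪≫
            Bicategory.whiskerLeftIso f ((α_ f' g' g).symm ≪≫
              Bicategory.whiskerRightIso e₁' g ≪≫ λ_ g) ≪≫ e₁
        · exact α_ g' g (f ≫ f') ≪≫
            Bicategory.whiskerLeftIso g' ((α_ g f f').symm ≪≫
              Bicategory.whiskerRightIso e₂ f' ≪≫ λ_ f') ≪≫ e₂' }

end Lie2Alg

/-! ### Lie algebra cohomology -/

section Cohomology

attribute [local instance] LieRing.ofAssociativeRing in
/-- Representations of the Lie algebra `g` on `V`: Lie algebra homomorphisms to `End V` with the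
commutator bracket. -/
abbrev LieRep (k g V : Type*) [Field k] [LieRing g] [LieAlgebra k g] [AddCommGroup V]
    [Module k V] : Type _ :=
  g →ₗ⁅k⁆ Module.End k V

variable {g V : Type*} [LieRing g] [LieAlgebra k g] [AddCommGroup V] [Module k V]

/-- The Lie algebra coboundary of an `(n+1)`-cochain `ω` with values in a representation `ρ`
(indices are counted from `0`):
`(δω)(v₀, …, v_{n+1}) = ∑ᵢ (-1)^i ρ(vᵢ) ω(…, v̂ᵢ, …)
  + ∑_{j<l} (-1)^{j+l} ω([vⱼ, vₗ], …, v̂ⱼ, …, v̂ₗ, …)`. -/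
def coboundary (ρ : LieRep k g V) (n : ℕ) :
    (g [⋀^Fin (n + 1)]→ₗ[k] V) →ₗ[k] ((Fin (n + 2) → g) → V) where
  toFun ω v :=
    (∑ i : Fin (n + 2), (-1 : ℤ) ^ (i : ℕ) • ρ (v i) (ω fun m => v (i.succAbove m))) +
      ∑ l : Fin (n + 2), ∑ j : Fin (n + 1),
        if j.castSucc < l then
          (-1 : ℤ) ^ ((j : ℕ) + (l : ℕ)) •
            ω (Matrix.vecCons ⁅v j.castSucc, v l⁆ fun m => v (l.succAbove (j.succAbove m)))
        else 0
  map_add' ω ω' := by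
    funext v
    simp only [AlternatingMap.add_apply, map_add, smul_add, Finset.sum_add_distrib, Pi.add_apply,
      ite_add_zero]
    abel
  map_smul' c ω := by
    funext v
    simp only [AlternatingMap.smul_apply, map_smul, RingHom.id_apply, Pi.smul_apply, smul_add,
      Finset.smul_sum, smul_ite, smul_zero, smul_comm c]

lemma coboundary_two_apply (ρ : LieRep k g V) (ω : g [⋀^Fin 3]→ₗ[k] V)
    (a b c d : g) :
    coboundary ρ 2 ω ![a, b, c, d] =
      ρ a (ω ![b, c, d]) - ρ b (ω ![a, c, d]) + ρ c (ω ![a, b, d]) - ρ d (ω ![a, b, c]) -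
        ω ![⁅a, b⁆, c, d] + ω ![⁅a, c⁆, b, d] - ω ![⁅a, d⁆, b, c] -
        ω ![⁅b, c⁆, a, d] + ω ![⁅b, d⁆, a, c] - ω ![⁅c, d⁆, a, b] := by
  obtain ⟨T, hT⟩ : ∃ T : g → g → g → V, ∀ f, ω f = T (f 0) (f 1) (f 2) :=
    ⟨fun x y z => ω ![x, y, z], fun f => congrArg ω (by ext i; fin_cases i <;> rfl)⟩
  simp [coboundary, hT, Fin.sum_univ_succ, Fin.succAbove, pow_succ]
  abel

lemma coboundary_one_apply (ρ : LieRep k g V) (θ : g [⋀^Fin 2]→ₗ[k] V)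
    (a b c : g) :
    coboundary ρ 1 θ ![a, b, c] =
      ρ a (θ ![b, c]) - ρ b (θ ![a, c]) + ρ c (θ ![a, b]) -
        θ ![⁅a, b⁆, c] + θ ![⁅a, c⁆, b] - θ ![⁅b, c⁆, a] := by
  obtain ⟨T, hT⟩ : ∃ T : g → g → V, ∀ f, θ f = T (f 0) (f 1) :=
    ⟨fun x y => θ ![x, y], fun f => congrArg θ (by ext i; fin_cases i <;> rfl)⟩
  simp [coboundary, hT, Fin.sum_univ_succ, Fin.succAbove, pow_succ]
  abel

/-- The space `Z³(g, V)` of 3-cocycles. -/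
def Z3 (ρ : LieRep k g V) : Submodule k (g [⋀^Fin 3]→ₗ[k] V) :=
  LinearMap.ker (coboundary ρ 2)

/-- The space `B³(g, V)` of 3-coboundaries. -/
def B3 (ρ : LieRep k g V) : Submodule k (g [⋀^Fin 3]→ₗ[k] V) where
  carrier := {ω | ∃ θ : g [⋀^Fin 2]→ₗ[k] V, ⇑ω = coboundary ρ 1 θ}
  add_mem' := by
    rintro _ _ ⟨θ, hθ⟩ ⟨θ', hθ'⟩
    exact ⟨θ + θ', by rw [map_add, ← hθ, ← hθ']; rfl⟩
  zero_mem' := ⟨0, by rw [map_zero]; rfl⟩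
  smul_mem' := by
    rintro c _ ⟨θ, hθ⟩
    exact ⟨c • θ, by rw [map_smul, ← hθ]; rfl⟩

/-- The third Lie algebra cohomology group `H³(g, V) = Z³(g, V) / B³(g, V)`. -/
abbrev H3 (ρ : LieRep k g V) : Type _ :=
  Z3 ρ ⧸ (B3 ρ).submoduleOf (Z3 ρ)

/-- The cohomology class `[ω]` of a 3-cocycle. -/
def H3.mk (ρ : LieRep k g V) (ω : Z3 ρ) : H3 ρ :=
  Submodule.Quotient.mk ω

attribute [local instance] LieRing.ofAssociativeRing in
lemma LieRep.map_lie_apply (ρ : LieRep k g V) (x y : g) (v : V) :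
    ρ ⁅x, y⁆ v = ρ x (ρ y v) - ρ y (ρ x v) := by
  rw [LieHom.map_lie]
  rfl

variable {g' V' : Type*} [LieRing g'] [LieAlgebra k g'] [AddCommGroup V'] [Module k V']

/-- The map of cochain spaces `ω ↦ ψ ∘ ω ∘ (φ⁻¹ × ⋯ × φ⁻¹)`. -/
def transport (φ : g ≃ₗ⁅k⁆ g') (ψ : V ≃ₗ[k] V') (n : ℕ) :
    (g [⋀^Fin n]→ₗ[k] V) →ₗ[k] (g' [⋀^Fin n]→ₗ[k] V') where
  toFun ω := (ψ.toLinearMap.compAlternatingMap ω).compLinearMap φ.symm.toLinearEquiv.toLinearMap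
  map_add' ω ω' := by ext; simp
  map_smul' c ω := by ext; simp

@[simp] lemma transport_apply (φ : g ≃ₗ⁅k⁆ g') (ψ : V ≃ₗ[k] V') (n : ℕ)
    (ω : g [⋀^Fin n]→ₗ[k] V) (v : Fin n → g') :
    transport φ ψ n ω v = ψ (ω fun i => φ.symm (v i)) := rfl

lemma coboundary_transport {ρ : LieRep k g V} {ρ' : LieRep k g' V'}
    (φ : g ≃ₗ⁅k⁆ g') (ψ : V ≃ₗ[k] V') (h : ∀ x v, ψ (ρ x v) = ρ' (φ x) (ψ v)) (n : ℕ)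
    (ω : g [⋀^Fin (n + 1)]→ₗ[k] V) (v : Fin (n + 2) → g') :
    coboundary ρ' n (transport φ ψ (n + 1) ω) v =
      ψ (coboundary ρ n ω fun i => φ.symm (v i)) := by
  have hc : ∀ (x y : g') (u : Fin n → g'),
      (fun i => φ.symm (Matrix.vecCons ⁅x, y⁆ u i)) =
        Matrix.vecCons ⁅φ.symm x, φ.symm y⁆ fun i => φ.symm (u i) := by
    intro x y u
    funext i
    refine Fin.cases ?_ (fun j => ?_) i
    · exact φ.symm.map_lie x y
    · simp
  simp only [coboundary, LinearMap.coe_mk, AddHom.coe_mk, transport_apply, hc, map_add, map_sum,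
    map_zsmul, h, LieEquiv.apply_symm_apply, apply_ite ψ, map_zero]

/-- The map `H³(g, V) → H³(g', V')` induced by an isomorphism of Lie algebras and a compatible
isomorphism of representations. -/
def H3.map {ρ : LieRep k g V} {ρ' : LieRep k g' V'}
    (φ : g ≃ₗ⁅k⁆ g') (ψ : V ≃ₗ[k] V') (h : ∀ x v, ψ (ρ x v) = ρ' (φ x) (ψ v)) :
    H3 ρ →ₗ[k] H3 ρ' :=
  Submodule.mapQ _ _
    ((transport φ ψ 3).restrict fun ω (hω : ω ∈ Z3 ρ) => by
      have h0 : coboundary ρ 2 ω = 0 := hω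
      change coboundary ρ' 2 _ = 0
      funext v
      rw [coboundary_transport φ ψ h, h0]
      simp)
    (by
      rintro ⟨ω, hω⟩ ⟨θ, hθ⟩
      refine ⟨transport φ ψ 2 θ, ?_⟩
      funext v
      rw [coboundary_transport φ ψ h, ← hθ]
      rfl)

lemma H3.map_mk {ρ : LieRep k g V} {ρ' : LieRep k g' V'}
    (φ : g ≃ₗ⁅k⁆ g') (ψ : V ≃ₗ[k] V') (h : ∀ x v, ψ (ρ x v) = ρ' (φ x) (ψ v))
    (ω : Z3 ρ) (ω' : Z3 ρ') (hω : ∀ v, ω'.1 v = ψ (ω.1 fun i => φ.symm (v i))) :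
    H3.map φ ψ h (H3.mk ρ ω) = H3.mk ρ' ω' := by
  unfold H3.map H3.mk
  rw [Submodule.mapQ_apply]
  congr 1
  ext v
  exact (hω v).symm

end Cohomology

/-! ### Quadruples `(g, V, ρ, [ω])` -/

/-- A Lie algebra `g`, a vector space `V`, a representation `ρ` of `g` on `V` and an element
of `H³(g, V)`. -/
structure Quadruple (k : Type w) [Field k] where
  g : Type u
  V : Type u
  [lieRing : LieRing g]
  [lieAlgebra : LieAlgebra k g]
  [addCommGroup : AddCommGroup V]
  [module : Module k V]
  ρ : LieRep k g V
  cls : H3 ρ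

attribute [instance] Quadruple.lieRing Quadruple.lieAlgebra Quadruple.addCommGroup Quadruple.module

namespace Quadruple

/-- An isomorphism of quadruples: an isomorphism of Lie algebras and a compatible isomorphism of
representations such that the induced map on `H³` carries one class to the other. -/
structure Iso (Q Q' : Quadruple.{w, u} k) where
  φ : Q.g ≃ₗ⁅k⁆ Q'.g
  ψ : Q.V ≃ₗ[k] Q'.V
  equivariant : ∀ x v, ψ (Q.ρ x v) = Q'.ρ (φ x) (ψ v)
  map_cls : H3.map φ ψ equivariant Q.cls = Q'.cls

/-- Isomorphism of quadruples as an equivalence relation. -/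
instance isoSetoid (k : Type w) [Field k] : Setoid (Quadruple.{w, u} k) where
  r Q Q' := Nonempty (Iso Q Q')
  iseqv :=
    { refl := fun Q => ⟨⟨LieEquiv.refl, LinearEquiv.refl k Q.V, fun _ _ => rfl, by
        obtain ⟨ω, hω⟩ := Submodule.Quotient.mk_surjective _ Q.cls
        rw [← hω]
        exact H3.map_mk _ _ _ ω ω fun v => rfl⟩⟩
      symm := by
        rintro Q Q' ⟨⟨φ, ψ, h, hc⟩⟩
        have h' : ∀ x v, ψ.symm (Q'.ρ x v) = Q.ρ (φ.symm x) (ψ.symm v) := fun x v => by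
          rw [LinearEquiv.symm_apply_eq, h]
          simp
        refine ⟨⟨φ.symm, ψ.symm, h', ?_⟩⟩
        rw [← hc]
        obtain ⟨ω, hω⟩ := Submodule.Quotient.mk_surjective _ Q.cls
        rw [← hω]
        exact H3.map_mk φ.symm ψ.symm h' _ ω fun v => by
          simp [LinearMap.restrict_apply]
      trans := by
        rintro Q Q' Q'' ⟨⟨φ, ψ, h, hc⟩⟩ ⟨⟨φ', ψ', h', hc'⟩⟩
        refine ⟨⟨φ.trans φ', ψ.trans ψ', fun x v => by simp [h, h'], ?_⟩⟩
        rw [← hc', ← hc]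
        obtain ⟨ω, hω⟩ := Submodule.Quotient.mk_surjective _ Q.cls
        rw [← hω]
        exact H3.map_mk _ _ _ ω _ fun v => rfl }

end Quadruple

/-! ### The skeletal Lie 2-algebra of a 3-cocycle -/

section OfCocycle

variable {g V : Type u} [LieRing g] [LieAlgebra k g] [AddCommGroup V] [Module k V]

/-- The skeletal 2-vector space with objects `g` and morphisms `g ⊕ V`: the pair `(x, f)` is the
morphism `x ⟶ x` with arrow part `f`. -/
def skeletalTwoVect (k : Type w) [Field k] (g V : Type u) [AddCommGroup g] [Module k g]
    [AddCommGroup V] [Module k V] : TwoVect.{w, u} k where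
  obj := g
  mor := g × V
  src := LinearMap.fst k g V
  tgt := LinearMap.fst k g V
  ident := LinearMap.inl k g V
  comp :=
    { toFun := fun p => (p.1.1.1, p.1.1.2 + p.1.2.2)
      map_add' := fun p q => by ext <;> simp; abel
      map_smul' := fun c p => by ext <;> simp }
  src_ident _ := rfl
  tgt_ident _ := rfl
  src_comp _ _ _ := rfl
  tgt_comp _ _ h := h
  assoc f g h _ _ := by ext <;> simp [add_assoc]
  ident_comp f := by ext <;> simp
  comp_ident f := by ext <;> simp

/-- The bracket on objects of the skeletal Lie 2-algebra. -/
def skeletalObj (k : Type w) [Field k] (g : Type u) [LieRing g] [LieAlgebra k g] :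
    g →ₗ[k] g →ₗ[k] g :=
  LinearMap.mk₂ k (fun x y => ⁅x, y⁆) (fun _ _ _ => add_lie _ _ _)
    (fun _ _ _ => smul_lie _ _ _) (fun _ _ _ => lie_add _ _ _) (fun _ _ _ => lie_smul _ _ _)

/-- The bracket on morphisms of the skeletal Lie 2-algebra. -/
def skeletalMor (ρ : LieRep k g V) : g × V →ₗ[k] g × V →ₗ[k] g × V :=
  LinearMap.mk₂ k (fun a b => (⁅a.1, b.1⁆, ρ a.1 b.2 - ρ b.1 a.2))
    (fun a a' b => by ext <;> simp; abel)
    (fun c a b => by ext <;> simp [smul_sub])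
    (fun a b b' => by ext <;> simp; abel)
    (fun c a b => by ext <;> simp [smul_sub])

/-- The bracket functor: `[x, y]` on objects and
`[(x, f), (y, h)] = ([x, y], ρ(x) h - ρ(y) f)` on morphisms. -/
def skeletalBracket (ρ : LieRep k g V) :
    BilinearFunctor (skeletalTwoVect k g V) (skeletalTwoVect k g V) (skeletalTwoVect k g V) where
  onObj := skeletalObj k g
  onMor := skeletalMor ρ
  src_map _ _ := rfl
  tgt_map _ _ := rfl
  map_ident (x y : g) := by
    change ((⁅x, y⁆, ρ x 0 - ρ y 0) : g × V) = (⁅x, y⁆, 0)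
    simp
  map_cmp := by
    intro (⟨x, a⟩ : g × V) (⟨x', a'⟩ : g × V) (⟨y, b⟩ : g × V) (⟨y', b'⟩ : g × V) h h'
    obtain rfl : x = x' := h
    obtain rfl : y = y' := h'
    change ((⁅x, y⁆, ρ x (b + b') - ρ y (a + a')) : g × V) =
      (⁅x, y⁆, (ρ x b - ρ y a) + (ρ x b' - ρ y a'))
    rw [map_add, map_add]
    congr 1
    abel

lemma vec_eq_update₀ {A : Type*} [Zero A] (x y z : A) :
    ![x, y, z] = Function.update ![0, y, z] 0 x := by
  ext i; fin_cases i <;> rfl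

lemma vec_eq_update₁ {A : Type*} [Zero A] (x y z : A) :
    ![x, y, z] = Function.update ![x, 0, z] 1 y := by
  ext i; fin_cases i <;> rfl

lemma vec_eq_update₂ {A : Type*} [Zero A] (x y z : A) :
    ![x, y, z] = Function.update ![x, y, 0] 2 z := by
  ext i; fin_cases i <;> rfl

/-- The trilinear map `(x, y, z) ↦ ([[x,y],z], ω(x,y,z))`. -/
def skeletalJac (ω : g [⋀^Fin 3]→ₗ[k] V) : g →ₗ[k] g →ₗ[k] g →ₗ[k] g × V :=
  { toFun := fun x => LinearMap.mk₂ k (fun y z => (⁅⁅x, y⁆, z⁆, ω ![x, y, z]))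
      (fun y y' z => by
        ext
        · simp
        · simp only [Prod.snd_add]
          rw [vec_eq_update₁ x (y + y') z, vec_eq_update₁ x y z, vec_eq_update₁ x y' z,
            ω.map_update_add])
      (fun c y z => by
        ext
        · simp
        · simp only [Prod.smul_snd]
          rw [vec_eq_update₁ x (c • y) z, vec_eq_update₁ x y z, ω.map_update_smul])
      (fun y z z' => by
        ext
        · simp
        · simp only [Prod.snd_add]
          rw [vec_eq_update₂ x y (z + z'), vec_eq_update₂ x y z, vec_eq_update₂ x y z',
            ω.map_update_add])
      (fun c y z => by
        ext
        · simp
        · simp only [Prod.smul_snd]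
          rw [vec_eq_update₂ x y (c • z), vec_eq_update₂ x y z, ω.map_update_smul])
    map_add' := fun x x' => LinearMap.ext₂ fun y z => by
      ext
      · simp
      · simp only [LinearMap.add_apply, LinearMap.mk₂_apply, Prod.snd_add]
        rw [vec_eq_update₀ (x + x') y z, vec_eq_update₀ x y z, vec_eq_update₀ x' y z,
          ω.map_update_add]
    map_smul' := fun c x => LinearMap.ext₂ fun y z => by
      ext
      · simp
      · simp only [LinearMap.smul_apply, LinearMap.mk₂_apply, Prod.smul_snd,
          RingHom.id_apply]
        rw [vec_eq_update₀ (c • x) y z, vec_eq_update₀ x y z, ω.map_update_smul] }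

lemma alternating_swap₁₂ (ω : g [⋀^Fin 3]→ₗ[k] V) (x y z : g) :
    ω ![y, x, z] = -ω ![x, y, z] := by
  rw [← ω.map_swap ![x, y, z] (show (0 : Fin 3) ≠ 1 by decide)]
  congr 1
  ext i
  fin_cases i <;> rfl

lemma alternating_swap₂₃ (ω : g [⋀^Fin 3]→ₗ[k] V) (x y z : g) :
    ω ![x, z, y] = -ω ![x, y, z] := by
  rw [← ω.map_swap ![x, y, z] (show (1 : Fin 3) ≠ 2 by decide)]
  congr 1
  ext i
  fin_cases i <;> rfl

lemma jacobi_identity (x y z : g) : ⁅⁅x, y⁆, z⁆ = ⁅x, ⁅y, z⁆⁆ + ⁅⁅x, z⁆, y⁆ := by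
  rw [lie_lie, ← lie_skew ⁅x, z⁆ y, sub_eq_add_neg]

/-- The Jacobiator `J_{x,y,z} = ([[x,y],z], ω(x,y,z))`. -/
def skeletalJacobiator (ρ : LieRep k g V) (ω : g [⋀^Fin 3]→ₗ[k] V) :
    Jacobiator (skeletalBracket ρ) where
  app := skeletalJac (g := g) (V := V) ω
  src_app _ _ _ := rfl
  tgt_app x y z := jacobi_identity (g := g) x y z
  naturality := by
    intro (⟨x, a⟩ : g × V) (⟨y, b⟩ : g × V) (⟨z, c⟩ : g × V)
    change ((⁅⁅x, y⁆, z⁆, (ρ ⁅x, y⁆ c - ρ z (ρ x b - ρ y a)) + ω ![x, y, z]) : g × V) =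
      (⁅⁅x, y⁆, z⁆, ω ![x, y, z] +
        ((ρ x (ρ y c - ρ z b) - ρ ⁅y, z⁆ a) + (ρ ⁅x, z⁆ b - ρ y (ρ x c - ρ z a))))
    simp only [LieRep.map_lie_apply, map_sub]
    congr 1
    abel
  invertible _ _ _ := TwoVect.isInvertible _ _
  arrow_swap₁₂ (x y z : g) := by
    change ((⁅⁅y, x⁆, z⁆ - ⁅⁅y, x⁆, z⁆, ω ![y, x, z] - 0) : g × V) =
      -(⁅⁅x, y⁆, z⁆ - ⁅⁅x, y⁆, z⁆, ω ![x, y, z] - 0)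
    simp [alternating_swap₁₂ ω x y z]
  arrow_swap₂₃ (x y z : g) := by
    change ((⁅⁅x, z⁆, y⁆ - ⁅⁅x, z⁆, y⁆, ω ![x, z, y] - 0) : g × V) =
      -(⁅⁅x, y⁆, z⁆ - ⁅⁅x, y⁆, z⁆, ω ![x, y, z] - 0)
    simp [alternating_swap₂₃ ω x y z]

/-- The skeletal Lie 2-algebra of `(g, V, ρ, ω)` for a 3-cocycle `ω`. -/
def skeletalLie2Alg (ρ : LieRep k g V) (ω : Z3 ρ) : Lie2Alg.{w, u} k where
  carrier := skeletalTwoVect k g V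
  bracket := skeletalBracket ρ
  bracket_skew := by
    constructor
    · exact fun x y => (lie_skew (L := g) x y).symm
    · intro (⟨x, a⟩ : g × V) (⟨y, b⟩ : g × V)
      change ((⁅x, y⁆, ρ x b - ρ y a) : g × V) = -(⁅y, x⁆, ρ y a - ρ x b)
      ext <;> simp
  jac := skeletalJacobiator ρ ω.1
  jacobiator_identity := by
    intro (a : g) (b : g) (c : g) (d : g)
    obtain ⟨ω, hω⟩ := ω
    have h : coboundary ρ 2 ω ![a, b, c, d] = 0 := congrFun hω _
    rw [coboundary_two_apply] at h
    refine Prod.ext rfl ?_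
    change (ω ![⁅a, b⁆, c, d] + ((ρ ⁅⁅a, b⁆, d⁆ 0 - ρ c (ω ![a, b, d])) + 0)) +
        (ω ![a, ⁅b, d⁆, c] + ω ![⁅a, d⁆, b, c] + ω ![a, b, ⁅c, d⁆]) =
      (((ρ ⁅⁅a, b⁆, c⁆ 0 - ρ d (ω ![a, b, c])) + (ω ![⁅a, c⁆, b, d] + ω ![a, ⁅b, c⁆, d])) +
          ((ρ ⁅⁅a, c⁆, d⁆ 0 - ρ b (ω ![a, c, d])) + 0)) +
        ((ρ a (ω ![b, c, d]) - ρ ⁅⁅b, c⁆, d⁆ 0) + 0)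
    have h₁ := alternating_swap₁₂ ω a ⁅b, d⁆ c
    have h₂ := alternating_swap₁₂ ω a ⁅b, c⁆ d
    have h₃ := alternating_swap₂₃ ω a b ⁅c, d⁆
    have h₄ := alternating_swap₁₂ ω a ⁅c, d⁆ b
    simp only [map_zero]
    grind

end OfCocycle

end LieTwo

/-!
Equivalence classes of Lie 2-algebras are compared with isomorphism classes of quadruples through
the assignment of the skeletal Lie 2-algebra to a quadruple with a chosen cocycle. The bijection of
the theorem is the inverse of this map, so three things have to be shown.

*Well-definedness.* If the cocycles of two isomorphic quadruples differ by the coboundary of a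
cochain `θ`, then `F₂ = θ` makes the isomorphism a homomorphism of skeletal Lie 2-algebras
(`skeletalHom`): on arrow parts, the coherence law of a homomorphism says precisely that the
cocycles differ by the coboundary of `F₂`.

*Injectivity.* A natural transformation between linear functors of skeletal 2-vector spaces forces
them to be equal, so an equivalence of skeletal Lie 2-algebras is invertible on objects and on
morphisms, and the same reading of its coherence law gives equal classes
(`exists_iso_of_objEquiv`). In characteristic different from `2`, skew-symmetric maps are
alternating.

*Surjectivity.* In a Lie 2-algebra `L`, let `g` be the space of isomorphism classes of objects and
`V` the space of endomorphisms of the object `0`. Choose a linear section `s` of `L₀ → g` and,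
linearly in `x`, a morphism `h x : 0 ⟶ x - s [x]`. The bracket and the action of `L` induce a Lie
algebra structure on `g` and a representation on `V`, and `(a, b) ↦ h [s a, s b]` measures the
failure of `s` to preserve brackets. Correcting the Jacobiator by this defect gives a cochain
with values in `V`; its cocycle law (`jacobiator_cocycle`) is the Jacobiator identity combined with
the naturality of the Jacobiator. The section `s` extends to a homomorphism from the skeletal Lie
2-algebra of this cocycle to `L`.

In the first and the last step, the homomorphism is an equivalence by a general criterion
(`objEquiv_of_isFullyFaithful`): it suffices that its underlying linear functor is fully faithful
and essentially surjective. Over a field the inverse functor and the natural isomorphisms can be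
chosen linearly, and the rest of the structure is transported along them.
-/

namespace LieTwo

variable {k : Type w} [Field k]

namespace Lie2Alg

variable {L L' L'' : Lie2Alg.{w, u} k}

/-! ### Recognizing equivalences of Lie 2-algebras -/

/-- The coherence law is transported along a linear natural transformation `θ : F ⇒ G` that
satisfies the law of a 2-homomorphism: every morphism of a 2-vector space is invertible, so `θ` can
be cancelled from the hexagon of `F`. -/
lemma PreHom.coherence_of_square (F : Hom L L') (G : PreHom L L')
    (θ : LinearNatTrans F.toLinearFunctor G.toLinearFunctor)
    (square : ∀ x y, L'.bracket.onMor (θ.app x) (θ.app y) + G.two x y -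
        L'.carrier.ident (L'.bracket.onObj (G.onObj x) (G.onObj y)) =
      F.two x y + θ.app (L.bracket.onObj x y) -
        L'.carrier.ident (F.onObj (L.bracket.onObj x y)))
    (x y z : L.carrier.obj) : G.upperPath x y z = G.lowerPath x y z := by
  have h := F.coherence x y z
  have hJ := L'.jac.naturality (θ.app x) (θ.app y) (θ.app z)
  have hθ := θ.naturality (L.jac.app x y z)
  have s₁ := congrArg (L'.bracket.onMor (θ.app x)) (square y z)
  have s₂ := congrArg (fun m => L'.bracket.onMor m (θ.app y)) (square x z)
  have s₃ := congrArg (fun m => L'.bracket.onMor m (θ.app z)) (square x y)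
  have q₁ := square x (L.bracket.onObj y z)
  have q₂ := square (L.bracket.onObj x z) y
  have q₃ := square (L.bracket.onObj x y) z
  have b₁ := L'.bracket.map_cmp (θ.app x) (L'.carrier.ident (G.onObj x))
    (L'.bracket.onMor (θ.app y) (θ.app z)) (G.two y z) (by simp) (by simp)
  have b₂ := L'.bracket.map_cmp (L'.bracket.onMor (θ.app x) (θ.app z)) (G.two x z)
    (θ.app y) (L'.carrier.ident (G.onObj y)) (by simp) (by simp)
  have b₃ := L'.bracket.map_cmp (L'.bracket.onMor (θ.app x) (θ.app y)) (G.two x y)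
    (θ.app z) (L'.carrier.ident (G.onObj z)) (by simp) (by simp)
  have c₁ := L'.bracket.map_cmp (L'.carrier.ident (F.onObj x)) (θ.app x)
    (F.two y z) (θ.app (L.bracket.onObj y z)) (by simp) (by simp)
  have c₂ := L'.bracket.map_cmp (F.two x z) (θ.app (L.bracket.onObj x z))
    (L'.carrier.ident (F.onObj y)) (θ.app y) (by simp) (by simp)
  have c₃ := L'.bracket.map_cmp (F.two x y) (θ.app (L.bracket.onObj x y))
    (L'.carrier.ident (F.onObj z)) (θ.app z) (by simp) (by simp)
  simp [PreHom.upperPath, PreHom.lowerPath, TwoVect.cmp_eq] at *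
  clear square
  grind

/-- If `G` is faithful and `F G` is coherent, then `F` is coherent. -/
lemma PreHom.coherence_of_comp (F : PreHom L L') (G : Hom L' L'')
    (hG : ∀ f f' : L'.carrier.mor, L'.carrier.src f = L'.carrier.src f' →
      L'.carrier.tgt f = L'.carrier.tgt f' → G.onMor f = G.onMor f' → f = f')
    (h : ∀ x y z, (F.comp G.toPreHom).upperPath x y z = (F.comp G.toPreHom).lowerPath x y z)
    (x y z : L.carrier.obj) : F.upperPath x y z = F.lowerPath x y z := by
  refine hG _ _ (by simp [PreHom.upperPath, PreHom.lowerPath])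
    (by simp [PreHom.upperPath, PreHom.lowerPath]) ?_
  have h0 := h x y z
  have h1 := G.coherence (F.onObj x) (F.onObj y) (F.onObj z)
  have n1 := G.two_naturality (F.two x y) (L'.carrier.ident (F.onObj z))
  have n2 := G.two_naturality (L'.carrier.ident (F.onObj x)) (F.two y z)
  have n3 := G.two_naturality (F.two x z) (L'.carrier.ident (F.onObj y))
  simp [PreHom.upperPath, PreHom.lowerPath, TwoVect.cmp_eq, PreHom.comp] at h0 h1 n1 n2 n3 ⊢
  clear h hG
  grind

end Lie2Alg

namespace LinearFunctor

variable {V W : TwoVect.{w, u} k} (F : LinearFunctor V W)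

/-- A linear functor is fully faithful if it is bijective on each set of morphisms `x ⟶ y`. -/
structure IsFullyFaithful : Prop where
  faithful : ∀ f f', V.src f = V.src f' → V.tgt f = V.tgt f' → F.onMor f = F.onMor f' → f = f'
  full : ∀ x y m, W.src m = F.onObj x → W.tgt m = F.onObj y →
    ∃ f, V.src f = x ∧ V.tgt f = y ∧ F.onMor f = m

/-- A linear functor is essentially surjective if each object is the target of a morphism out of an
object in the image; all morphisms of a 2-vector space are invertible. -/
def IsEssSurj : Prop :=
  ∀ X, ∃ x m, W.src m = F.onObj x ∧ W.tgt m = X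

variable {F}

/-- Over a field, preimages under a fully faithful linear functor can be chosen linearly. -/
lemma IsFullyFaithful.exists_linear_preimage (hF : F.IsFullyFaithful) :
    ∃ P : V.obj × W.mor × V.obj →ₗ[k] V.mor, ∀ x m y, W.src m = F.onObj x →
      W.tgt m = F.onObj y →
        V.src (P (x, m, y)) = x ∧ V.tgt (P (x, m, y)) = y ∧ F.onMor (P (x, m, y)) = m := by
  obtain ⟨P, hP⟩ := LinearMap.exists_leftInverse_of_injective
    (V.src.prod (F.onMor.prod V.tgt)) (LinearMap.ker_eq_bot.2 fun f f' h => by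
      replace h : (V.src f, F.onMor f, V.tgt f) = (V.src f', F.onMor f', V.tgt f') := h
      simp only [Prod.mk.injEq] at h
      exact hF.faithful f f' h.1 h.2.2 h.2.1)
  refine ⟨P, fun x m y hx hy => ?_⟩
  obtain ⟨f, rfl, rfl, rfl⟩ := hF.full x y m hx hy
  have h : P (V.src f, F.onMor f, V.tgt f) = f := LinearMap.congr_fun hP f
  rw [h]
  exact ⟨rfl, rfl, rfl⟩

/-- Over a field, the data of essential surjectivity can be chosen linearly. -/
lemma IsEssSurj.exists_linear (hF : F.IsEssSurj) :
    ∃ (G : W.obj →ₗ[k] V.obj) (ε : W.obj →ₗ[k] W.mor),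
      (∀ X, W.src (ε X) = F.onObj (G X)) ∧ ∀ X, W.tgt (ε X) = X := by
  let E : Submodule k (V.obj × W.mor) :=
    LinearMap.eqLocus (F.onObj ∘ₗ LinearMap.fst k _ _) (W.src ∘ₗ LinearMap.snd k _ _)
  obtain ⟨s, hs⟩ := LinearMap.exists_rightInverse_of_surjective
    ((W.tgt ∘ₗ LinearMap.snd k _ _) ∘ₗ E.subtype) (LinearMap.range_eq_top.2 fun X => by
      obtain ⟨x, m, hx, hm⟩ := hF X
      exact ⟨⟨(x, m), hx.symm⟩, hm⟩)
  exact ⟨LinearMap.fst k _ _ ∘ₗ E.subtype ∘ₗ s, LinearMap.snd k _ _ ∘ₗ E.subtype ∘ₗ s,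
    fun X => (s X).2.symm, LinearMap.congr_fun hs⟩

end LinearFunctor

namespace Lie2Alg

variable {L L' : Lie2Alg.{w, u} k}

/-- Every 2-homomorphism is an isomorphism. -/
def Hom₂.toIso {F G : L ⟶ L'} (θ : Hom₂ F G) : F ≅ G where
  hom := θ
  inv :=
    show Hom₂ G F from
    { app := L'.carrier.ident ∘ₗ (Hom.toPreHom F).onObj +
        L'.carrier.ident ∘ₗ (Hom.toPreHom G).onObj - θ.app
      src_app := fun x => by simp
      tgt_app := fun x => by simp
      naturality := fun f => by
        have h := θ.naturality f
        simp [TwoVect.cmp_eq] at h ⊢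
        grind
      square := fun x y => by
        have h := θ.square x y
        have h₁ := L'.bracket.map_cmp (θ.app x) (L'.carrier.ident ((Hom.toPreHom F).onObj x) +
          L'.carrier.ident ((Hom.toPreHom G).onObj x) - θ.app x) (θ.app y)
          (L'.carrier.ident ((Hom.toPreHom F).onObj y) +
          L'.carrier.ident ((Hom.toPreHom G).onObj y) - θ.app y) (by simp) (by simp)
        simp [TwoVect.cmp_eq] at h h₁ ⊢
        grind }
  hom_inv_id := Hom₂.ext_app fun x => by
    change L'.carrier.cmp (θ.app x) _ _ = L'.carrier.ident _
    simp [TwoVect.cmp_eq]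
  inv_hom_id := Hom₂.ext_app fun x => by
    change L'.carrier.cmp _ (θ.app x) _ = L'.carrier.ident _
    simp [TwoVect.cmp_eq]

end Lie2Alg

namespace Lie2Alg

variable {L L' : Lie2Alg.{w, u} k}

/-- A homomorphism of Lie 2-algebras whose underlying linear functor is fully faithful and
essentially surjective is an equivalence. The inverse functor `G` and `ε : F G ⇒ 1` are
the linear ones. The transformation `G₂` is the unique one for which `ε` is a 2-homomorphism;
its coherence holds after applying `F`, where it is the coherence of the identity transported
along `ε`. -/
theorem objEquiv_of_isFullyFaithful (F : L ⟶ L')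
    (hF : (Hom.toPreHom F).toLinearFunctor.IsFullyFaithful)
    (hS : (Hom.toPreHom F).toLinearFunctor.IsEssSurj) : ObjEquiv L L' := by
  change Hom L L' at F
  obtain ⟨P, hP⟩ := hF.exists_linear_preimage
  obtain ⟨G₀, ε, hε, hε'⟩ := hS.exists_linear
  -- `G₁ f` is the preimage of the composite of `ε_x`, `f` and the inverse of
  -- `ε_y`, for `f : x ⟶ y`.
  obtain ⟨G₁, hG₁⟩ : ∃ G₁ : L'.carrier.mor →ₗ[k] L.carrier.mor, ∀ f,
      L.carrier.src (G₁ f) = G₀ (L'.carrier.src f) ∧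
      L.carrier.tgt (G₁ f) = G₀ (L'.carrier.tgt f) ∧
      F.onMor (G₁ f) = ε (L'.carrier.src f) + f - L'.carrier.ident (L'.carrier.src f) +
        L'.carrier.ident (F.onObj (G₀ (L'.carrier.tgt f))) - ε (L'.carrier.tgt f) :=
    ⟨P ∘ₗ (G₀ ∘ₗ L'.carrier.src).prod ((ε ∘ₗ L'.carrier.src + LinearMap.id -
        L'.carrier.ident ∘ₗ L'.carrier.src +
        L'.carrier.ident ∘ₗ F.onObj ∘ₗ G₀ ∘ₗ L'.carrier.tgt - ε ∘ₗ L'.carrier.tgt).prod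
          (G₀ ∘ₗ L'.carrier.tgt)),
      fun f => hP _ _ _ (by simp [hε]) (by simp [hε'])⟩
  -- `G₂(x, y)` is the preimage of the composite of the inverse of `F₂(G₀ x, G₀ y)`, the morphism
  -- `[ε_x, ε_y]` and the inverse of `ε_{[x, y]}`.
  obtain ⟨G₂, hG₂⟩ : ∃ G₂ : L'.carrier.obj →ₗ[k] L'.carrier.obj →ₗ[k] L.carrier.mor, ∀ x y,
      L.carrier.src (G₂ x y) = L.bracket.onObj (G₀ x) (G₀ y) ∧
      L.carrier.tgt (G₂ x y) = G₀ (L'.bracket.onObj x y) ∧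
      F.onMor (G₂ x y) = L'.carrier.ident (F.onObj (L.bracket.onObj (G₀ x) (G₀ y))) -
        F.two (G₀ x) (G₀ y) + L'.bracket.onMor (ε x) (ε y) +
        L'.carrier.ident (F.onObj (G₀ (L'.bracket.onObj x y))) - ε (L'.bracket.onObj x y) := by
    refine ⟨LinearMap.mk₂ k (fun x y => P (L.bracket.onObj (G₀ x) (G₀ y),
      L'.carrier.ident (F.onObj (L.bracket.onObj (G₀ x) (G₀ y))) -
        F.two (G₀ x) (G₀ y) + L'.bracket.onMor (ε x) (ε y) +
        L'.carrier.ident (F.onObj (G₀ (L'.bracket.onObj x y))) - ε (L'.bracket.onObj x y),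
      G₀ (L'.bracket.onObj x y))) ?_ ?_ ?_ ?_,
      fun x y => hP _ _ _ (by simp [hε]) (by simp [hε'])⟩
    · intro x x' y
      rw [← map_add]
      congr 1
      simp
      abel
    · intro c x y
      rw [← map_smul]
      congr 1
      simp [smul_add, smul_sub]
    · intro x y y'
      rw [← map_add]
      congr 1
      simp
      abel
    · intro c x y
      rw [← map_smul]
      congr 1
      simp [smul_add, smul_sub]
  have sG₁ := fun f => (hG₁ f).1
  have tG₁ := fun f => (hG₁ f).2.1
  have FG₁ := fun f => (hG₁ f).2.2
  have sG₂ := fun x y => (hG₂ x y).1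
  have tG₂ := fun x y => (hG₂ x y).2.1
  have FG₂ := fun x y => (hG₂ x y).2.2
  let G : PreHom L' L :=
    { onObj := G₀
      onMor := G₁
      src_map := sG₁
      tgt_map := tG₁
      map_ident := fun X => hF.faithful _ _ (by simp [sG₁]) (by simp [tG₁]) (by simp [FG₁])
      map_cmp := fun f g h => hF.faithful _ _ (by simp [sG₁]) (by simp [tG₁]) (by
        simp [TwoVect.cmp_eq, FG₁, sG₁, h])
      two := G₂
      src_two := sG₂
      tgt_two := tG₂
      two_naturality := fun f g => hF.faithful _ _ (by simp [sG₁, sG₂]) (by simp [tG₁, tG₂]) (by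
        have h := F.two_naturality (G₁ f) (G₁ g)
        have b₁ := L'.bracket.map_cmp (F.onMor (G₁ f)) (ε (L'.carrier.tgt f))
          (F.onMor (G₁ g)) (ε (L'.carrier.tgt g)) (by simp [tG₁, hε]) (by simp [tG₁, hε])
        have b₂ := L'.bracket.map_cmp (ε (L'.carrier.src f)) f (ε (L'.carrier.src g)) g
          (hε' _) (hε' _)
        simp [TwoVect.cmp_eq, FG₁, FG₂, sG₁, tG₁, sG₂, hε] at h b₁ b₂ ⊢
        clear * - h b₁ b₂
        grind)
      two_skew := fun x y => by
        have h := L.bracket_skew.1 (G₀ x) (G₀ y)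
        have h' := L'.bracket_skew.1 x y
        refine hF.faithful _ _ (by simp [sG₂, h]) (by simp [tG₂, h']) ?_
        simp only [map_neg, FG₂]
        rw [h, h', F.two_skew, L'.bracket_skew.2]
        simp only [map_neg]
        abel }
  -- `θ` is the inverse of `ε`.
  let θ : LinearNatTrans (Hom.id L').toLinearFunctor (G.comp F.toPreHom).toLinearFunctor :=
    { app := L'.carrier.ident + L'.carrier.ident ∘ₗ F.onObj ∘ₗ G₀ - ε
      src_app := fun x => by simp [hε, Hom.id]
      tgt_app := fun x => by simp [hε', PreHom.comp, G]
      naturality := fun f => by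
        simp [TwoVect.cmp_eq, PreHom.comp, G, Hom.id, FG₁, hε]
        abel }
  have hθ : ∀ x y, L'.bracket.onMor (θ.app x) (θ.app y) + (G.comp F.toPreHom).two x y -
        L'.carrier.ident (L'.bracket.onObj ((G.comp F.toPreHom).onObj x)
          ((G.comp F.toPreHom).onObj y)) =
      (Hom.id L').two x y + θ.app (L'.bracket.onObj x y) -
        L'.carrier.ident ((Hom.id L').onObj (L'.bracket.onObj x y)) := by
    intro x y
    have h := L'.bracket.map_cmp (θ.app x) (ε x) (θ.app y) (ε y) (by simp [hε, PreHom.comp, G])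
      (by simp [hε, PreHom.comp, G])
    simp [TwoVect.cmp_eq, PreHom.comp, G, Hom.id, FG₂, hε, θ] at h ⊢
    clear * - h
    grind
  let G' : Hom L' L := ⟨G, PreHom.coherence_of_comp G F hF.faithful
    (PreHom.coherence_of_square (Hom.id L') _ θ hθ)⟩
  let θ' : Hom₂ (Hom.id L') (Hom.comp G' F) :=
    { θ with
      square := fun x y => by
        have h := hθ x y
        rw [TwoVect.cmp_eq, TwoVect.cmp_eq, PreHom.src_two, LinearNatTrans.src_app]
        exact h }
  -- `η_x : x ⟶ G₀ (F₀ x)` is the preimage of `θ_{F₀ x}`.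
  obtain ⟨η₀, hη₀⟩ : ∃ η₀ : L.carrier.obj →ₗ[k] L.carrier.mor, ∀ x,
      L.carrier.src (η₀ x) = x ∧ L.carrier.tgt (η₀ x) = G₀ (F.onObj x) ∧
      F.onMor (η₀ x) = L'.carrier.ident (F.onObj x) +
        L'.carrier.ident (F.onObj (G₀ (F.onObj x))) - ε (F.onObj x) :=
    ⟨P ∘ₗ (LinearMap.id).prod ((θ.app ∘ₗ F.onObj).prod (G₀ ∘ₗ F.onObj)),
      fun x => hP _ _ _ (θ.src_app _) (θ.tgt_app _)⟩
  have sη := fun x => (hη₀ x).1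
  have tη := fun x => (hη₀ x).2.1
  have Fη := fun x => (hη₀ x).2.2
  let η : Hom₂ (Hom.id L) (Hom.comp F G') :=
    { app := η₀
      src_app := sη
      tgt_app := tη
      naturality := fun f => hF.faithful _ _ (by simp [sη, Hom.id])
        (by simp [tη, tG₁, Hom.comp, PreHom.comp, G', G]) (by
          simp [TwoVect.cmp_eq, Hom.id, Hom.comp, PreHom.comp, G', G, sη, Fη, sG₁, FG₁]
          abel)
      square := fun x y => hF.faithful _ _ (by simp [sη, Hom.id])
        (by simp [tη, tG₁, Hom.comp, PreHom.comp, G', G]) (by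
          have h := F.two_naturality (η₀ x) (η₀ y)
          have b := hθ (F.onObj x) (F.onObj y)
          simp [TwoVect.cmp_eq, Hom.id, Hom.comp, PreHom.comp, G', G, sη, tη, Fη, hε, sG₁, sG₂, FG₁,
            FG₂, θ]
            at h b ⊢
          clear * - h b
          grind) }
  exact ⟨F, G', ⟨(Hom₂.toIso η).symm⟩, ⟨(Hom₂.toIso θ').symm⟩⟩

end Lie2Alg

/-! ### Alternating maps from skew-symmetric ones -/

section Alternating

variable {M N : Type*} [AddCommGroup M] [Module k M] [AddCommGroup N] [Module k N]

lemma eq_zero_of_eq_neg_of_ringChar (hk : ringChar k ≠ 2) {v : N} (h : v = -v) : v = 0 := by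
  have h' : (2 : k) • v = 0 := by
    rw [two_smul]
    nth_rewrite 2 [h]
    exact add_neg_cancel v
  exact (smul_eq_zero.1 h').resolve_left (Ring.two_ne_zero hk)

/-- The alternating map of a skew-symmetric map `T` of two variables that is linear in the
first one. -/
def alternatingOfSkew₂ (hk : ringChar k ≠ 2) (T : M → M → N)
    (hadd : ∀ x x' y, T (x + x') y = T x y + T x' y)
    (hsmul : ∀ (c : k) x y, T (c • x) y = c • T x y)
    (h : ∀ x y, T y x = -T x y) : M [⋀^Fin 2]→ₗ[k] N where
  toFun v := T (v 0) (v 1)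
  map_update_add' {dec} v i x y := by
    obtain rfl := Subsingleton.elim dec (instDecidableEqFin 2)
    have hadd' : ∀ x y y', T x (y + y') = T x y + T x y' := fun x y y' => by
      rw [h _ x, hadd, h x, h x, neg_add, neg_neg, neg_neg]
    fin_cases i <;> simp [hadd, hadd']
  map_update_smul' {dec} v i c x := by
    obtain rfl := Subsingleton.elim dec (instDecidableEqFin 2)
    have hsmul' : ∀ (c : k) x y, T x (c • y) = c • T x y := fun c x y => by
      rw [h _ x, hsmul, h x, smul_neg, neg_neg]
    fin_cases i <;> simp [hsmul, hsmul']
  map_eq_zero_of_eq' v i j hv hij := by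
    have key : v 0 = v 1 := by
      fin_cases i <;> fin_cases j <;>
        first | exact hv | exact hv.symm | exact absurd rfl hij
    rw [key]
    exact eq_zero_of_eq_neg_of_ringChar hk (h _ _)

@[simp] lemma alternatingOfSkew₂_apply (hk : ringChar k ≠ 2) (T : M → M → N) (hadd) (hsmul) (h)
    (v : Fin 2 → M) :
    alternatingOfSkew₂ (k := k) hk T hadd hsmul h v = T (v 0) (v 1) := rfl

/-- The alternating map of a completely antisymmetric map `T` of three variables that is linear in
the first one. -/
def alternatingOfSkew₃ (hk : ringChar k ≠ 2) (T : M → M → M → N)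
    (hadd : ∀ x x' y z, T (x + x') y z = T x y z + T x' y z)
    (hsmul : ∀ (c : k) x y z, T (c • x) y z = c • T x y z)
    (h : ∀ x y z, T y x z = -T x y z) (h' : ∀ x y z, T x z y = -T x y z) :
    M [⋀^Fin 3]→ₗ[k] N where
  toFun v := T (v 0) (v 1) (v 2)
  map_update_add' {dec} v i x y := by
    obtain rfl := Subsingleton.elim dec (instDecidableEqFin 3)
    have hadd₁ : ∀ x y y' z, T x (y + y') z = T x y z + T x y' z := fun x y y' z => by
      rw [h _ x, hadd, h x, h x, neg_add, neg_neg, neg_neg]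
    have hadd₂ : ∀ x y z z', T x y (z + z') = T x y z + T x y z' := fun x y z z' => by
      rw [h' _ _ y, hadd₁, h' _ y, h' _ y, neg_add, neg_neg, neg_neg]
    fin_cases i <;> simp [hadd, hadd₁, hadd₂]
  map_update_smul' {dec} v i c x := by
    obtain rfl := Subsingleton.elim dec (instDecidableEqFin 3)
    have hsmul₁ : ∀ (c : k) x y z, T x (c • y) z = c • T x y z := fun c x y z => by
      rw [h _ x, hsmul, h x, smul_neg, neg_neg]
    have hsmul₂ : ∀ (c : k) x y z, T x y (c • z) = c • T x y z := fun c x y z => by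
      rw [h' _ _ y, hsmul₁, h' _ y, smul_neg, neg_neg]
    fin_cases i <;> simp [hsmul, hsmul₁, hsmul₂]
  map_eq_zero_of_eq' v i j hv hij := by
    have h₁ : ∀ x z, T x x z = 0 := fun x z => eq_zero_of_eq_neg_of_ringChar hk (h x x z)
    have h₂ : ∀ x z, T x z z = 0 := fun x z => eq_zero_of_eq_neg_of_ringChar hk (h' x z z)
    have key : v 0 = v 1 ∨ v 1 = v 2 ∨ v 0 = v 2 := by
      fin_cases i <;> fin_cases j <;>
        first
        | exact Or.inl hv
        | exact Or.inl hv.symm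
        | exact Or.inr (Or.inl hv)
        | exact Or.inr (Or.inl hv.symm)
        | exact Or.inr (Or.inr hv)
        | exact Or.inr (Or.inr hv.symm)
        | exact absurd rfl hij
    obtain e | e | e := key
    · rw [e, h₁]
    · rw [e, h₂]
    · rw [e, h', h₁, neg_zero]

end Alternating

/-! ### Cohomologous cocycles and equivalent skeletal Lie 2-algebras -/

section Skeletal

variable {g V g' V' : Type u} [LieRing g] [LieAlgebra k g] [AddCommGroup V] [Module k V]
  [LieRing g'] [LieAlgebra k g'] [AddCommGroup V'] [Module k V']

lemma alternating_swap (θ : g [⋀^Fin 2]→ₗ[k] V) (x y : g) : θ ![y, x] = -θ ![x, y] := by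
  rw [← θ.map_swap ![x, y] (show (0 : Fin 2) ≠ 1 by decide)]
  congr 1
  ext i
  fin_cases i <;> rfl

/-- Two classes correspond under `H3.map` when the transported cocycle differs by a coboundary,
written on arguments `φ x, φ y, φ z` to avoid inverses. -/
lemma H3.map_mk_eq_mk_iff {ρ : LieRep k g V} {ρ' : LieRep k g' V'} (φ : g ≃ₗ⁅k⁆ g')
    (ψ : V ≃ₗ[k] V') (h : ∀ x v, ψ (ρ x v) = ρ' (φ x) (ψ v)) (ω : Z3 ρ) (ω' : Z3 ρ') :
    H3.map φ ψ h (H3.mk ρ ω) = H3.mk ρ' ω' ↔ ∃ θ : g' [⋀^Fin 2]→ₗ[k] V', ∀ x y z,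
      ψ (ω.1 ![x, y, z]) - ω'.1 ![φ x, φ y, φ z] = coboundary ρ' 1 θ ![φ x, φ y, φ z] := by
  change Submodule.Quotient.mk _ = Submodule.Quotient.mk _ ↔ _
  rw [Submodule.Quotient.eq]
  change (∃ θ : g' [⋀^Fin 2]→ₗ[k] V', ⇑(transport φ ψ 3 ω.1 - ω'.1) = coboundary ρ' 1 θ) ↔ _
  refine exists_congr fun θ => ⟨fun H x y z => ?_, fun H => funext fun v => ?_⟩
  · rw [← H]
    simp only [AlternatingMap.sub_apply, transport_apply]
    congr 3
    ext i
    fin_cases i <;> simp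
  · have hv : v = ![φ (φ.symm (v 0)), φ (φ.symm (v 1)), φ (φ.symm (v 2))] := by
      ext i
      fin_cases i <;> simp
    rw [hv, ← H]
    simp only [AlternatingMap.sub_apply, transport_apply]
    congr 3
    ext i
    fin_cases i <;> simp

open Lie2Alg

/-- The homomorphism of skeletal Lie 2-algebras with `F₂ = θ` for a cochain `θ` whose coboundary
is the difference of the two cocycles. -/
def skeletalHom {ρ : LieRep k g V} {ρ' : LieRep k g' V'} (φ : g ≃ₗ⁅k⁆ g')
    (ψ : V ≃ₗ[k] V') (h : ∀ x v, ψ (ρ x v) = ρ' (φ x) (ψ v)) (ω : Z3 ρ) (ω' : Z3 ρ')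
    (θ : g' [⋀^Fin 2]→ₗ[k] V') (hθ : ∀ x y z, ψ (ω.1 ![x, y, z]) - ω'.1 ![φ x, φ y, φ z] =
      coboundary ρ' 1 θ ![φ x, φ y, φ z]) :
    Hom (skeletalLie2Alg ρ ω) (skeletalLie2Alg ρ' ω') where
  onObj := φ.toLinearEquiv.toLinearMap
  onMor := φ.toLinearEquiv.toLinearMap.prodMap ψ.toLinearMap
  src_map _ := rfl
  tgt_map _ := rfl
  map_ident (x : g) := Prod.ext rfl (map_zero ψ)
  map_cmp := by
    intro (⟨x, a⟩ : g × V) (⟨y, b⟩ : g × V) hxy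
    exact Prod.ext rfl (map_add ψ a b)
  two :=
    show g →ₗ[k] g →ₗ[k] g' × V' from
    LinearMap.mk₂ k (fun x y => (⁅φ x, φ y⁆, θ ![φ x, φ y]))
      (fun x x' y => by
        refine Prod.ext (by simp) ?_
        simp only [map_add, Prod.snd_add]
        exact θ.map_vecCons_add ![φ y] (φ x) (φ x'))
      (fun c x y => by
        refine Prod.ext (by simp) ?_
        simp only [map_smul, Prod.smul_snd]
        exact θ.map_vecCons_smul ![φ y] c (φ x))
      (fun x y y' => by
        refine Prod.ext (by simp) ?_
        simp only [map_add, Prod.snd_add, alternating_swap θ _ (φ x), ← neg_add]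
        exact congrArg Neg.neg (θ.map_vecCons_add ![φ x] (φ y) (φ y')))
      (fun c x y => by
        refine Prod.ext (by simp) ?_
        simp only [map_smul, Prod.smul_snd, alternating_swap θ _ (φ x), smul_neg]
        exact congrArg Neg.neg (θ.map_vecCons_smul ![φ x] c (φ y)))
  src_two _ _ := rfl
  tgt_two x y := (φ.map_lie (x : g) (y : g)).symm
  two_naturality := by
    intro (⟨x, a⟩ : g × V) (⟨y, b⟩ : g × V)
    refine Prod.ext rfl ?_
    change (ρ' (φ x) (ψ b) - ρ' (φ y) (ψ a)) + θ ![φ x, φ y] =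
      θ ![φ x, φ y] + ψ (ρ x b - ρ y a)
    rw [map_sub, h, h, add_comm]
  two_skew (x y : g) := Prod.ext (lie_skew _ _).symm (alternating_swap θ (φ y) (φ x))
  coherence (x y z : g) := by
    refine Prod.ext rfl ?_
    change (ω'.1 ![φ x, φ y, φ z] + ((ρ' (φ x) (θ ![φ y, φ z]) - ρ' ⁅φ y, φ z⁆ 0) +
        (ρ' ⁅φ x, φ z⁆ 0 - ρ' (φ y) (θ ![φ x, φ z])))) +
        (θ ![φ x, φ ⁅y, z⁆] + θ ![φ ⁅x, z⁆, φ y]) =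
      ((ρ' ⁅φ x, φ y⁆ 0 - ρ' (φ z) (θ ![φ x, φ y])) + θ ![φ ⁅x, y⁆, φ z]) + ψ (ω.1 ![x, y, z])
    have h₀ := hθ x y z
    rw [coboundary_one_apply] at h₀
    have h₁ := alternating_swap θ (φ x) ⁅φ y, φ z⁆
    simp only [LieEquiv.map_lie, map_zero] at h₀ ⊢
    grind

/-- Isomorphic quadruples have equivalent skeletal Lie 2-algebras. -/
lemma objEquiv_skeletalLie2Alg {ρ : LieRep k g V} {ρ' : LieRep k g' V'} (φ : g ≃ₗ⁅k⁆ g')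
    (ψ : V ≃ₗ[k] V') (h : ∀ x v, ψ (ρ x v) = ρ' (φ x) (ψ v)) (ω : Z3 ρ) (ω' : Z3 ρ')
    (hc : H3.map φ ψ h (H3.mk ρ ω) = H3.mk ρ' ω') :
    ObjEquiv (skeletalLie2Alg ρ ω) (skeletalLie2Alg ρ' ω') := by
  obtain ⟨θ, hθ⟩ := (H3.map_mk_eq_mk_iff φ ψ h ω ω').1 hc
  refine objEquiv_of_isFullyFaithful (skeletalHom φ ψ h ω ω' θ hθ) ⟨?_, ?_⟩ ?_
  · intro (⟨x, a⟩ : g × V) (⟨y, b⟩ : g × V) (hx : x = y) _ hab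
    exact Prod.ext hx (ψ.injective (congrArg Prod.snd hab))
  · intro (x : g) (y : g) (⟨z, c⟩ : g' × V') (hx : z = φ x) (hy : z = φ y)
    exact ⟨((x, ψ.symm c) : g × V), rfl, φ.injective (hx.symm.trans hy),
      Prod.ext hx.symm (ψ.apply_symm_apply c)⟩
  · intro (X : g')
    exact ⟨φ.symm X, ((X, 0) : g' × V'), (φ.apply_symm_apply X).symm, rfl⟩

/-- Naturally isomorphic linear functors between skeletal 2-vector spaces are equal. -/
lemma eq_of_skeletal_natTrans
    {F G : LinearFunctor (skeletalTwoVect k g V) (skeletalTwoVect k g' V')}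
    (θ : LinearNatTrans F G) : (∀ x, F.onObj x = G.onObj x) ∧ ∀ f, F.onMor f = G.onMor f := by
  have h : ∀ x, F.onObj x = G.onObj x := fun x => (θ.src_app x).symm.trans (θ.tgt_app x)
  refine ⟨h, fun (f : g × V) => Prod.ext ?_ ?_⟩
  · exact (F.src_map f).trans ((h f.1).trans (G.src_map f).symm)
  · have hn : (F.onMor f).2 + (θ.app f.1).2 = (θ.app f.1).2 + (G.onMor f).2 :=
      congrArg Prod.snd (θ.naturality f)
    rw [add_comm] at hn
    exact add_left_cancel hn

/-- An equivalence between skeletal Lie 2-algebras is invertible on objects and on morphisms, and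
its transformation `F₂` exhibits the difference of the cocycles as a coboundary. -/
lemma exists_iso_of_objEquiv (hk : ringChar k ≠ 2) {ρ : LieRep k g V} {ρ' : LieRep k g' V'}
    (ω : Z3 ρ) (ω' : Z3 ρ')
    (e : ObjEquiv (skeletalLie2Alg ρ ω) (skeletalLie2Alg ρ' ω')) :
    ∃ (φ : g ≃ₗ⁅k⁆ g') (ψ : V ≃ₗ[k] V') (h : ∀ x v, ψ (ρ x v) = ρ' (φ x) (ψ v)),
      H3.map φ ψ h (H3.mk ρ ω) = H3.mk ρ' ω' := by
  obtain ⟨F, G, ⟨α⟩, ⟨β⟩⟩ := e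
  change Hom _ _ at F G
  obtain ⟨hα₀, hα₁⟩ := eq_of_skeletal_natTrans (Hom₂.toLinearNatTrans α.hom)
  obtain ⟨hβ₀, hβ₁⟩ := eq_of_skeletal_natTrans (Hom₂.toLinearNatTrans β.hom)
  let F₀ : g →ₗ[k] g' := F.onObj
  let G₀ : g' →ₗ[k] g := G.onObj
  let F₁ : g × V →ₗ[k] g' × V' := F.onMor
  let G₁ : g' × V' →ₗ[k] g × V := G.onMor
  let F₂ : g →ₗ[k] g →ₗ[k] g' × V' := F.two
  have hGF₀ : ∀ x, G₀ (F₀ x) = x := hα₀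
  have hFG₀ : ∀ x, F₀ (G₀ x) = x := hβ₀
  have hGF₁ : ∀ f, G₁ (F₁ f) = f := hα₁
  have hFG₁ : ∀ f, F₁ (G₁ f) = f := hβ₁
  have hF₁ : ∀ f, (F₁ f).1 = F₀ f.1 := F.src_map
  have hG₁ : ∀ f, (G₁ f).1 = G₀ f.1 := G.src_map
  have hF₁' : ∀ x, F₁ (x, 0) = (F₀ x, 0) := F.map_ident
  have hF₂ : ∀ x y, (F₂ x y).1 = ⁅F₀ x, F₀ y⁆ := F.src_two
  have hF₂' : ∀ x y, (F₂ x y).1 = F₀ ⁅x, y⁆ := F.tgt_two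
  have hskew : ∀ x y, F₂ x y = -F₂ y x := F.two_skew
  have hF₁z : ∀ v, F₁ (0, v) = (0, (F₁ (0, v)).2) := fun v =>
    Prod.ext ((hF₁ _).trans (map_zero F₀)) rfl
  have hG₁z : ∀ v, G₁ (0, v) = (0, (G₁ (0, v)).2) := fun v =>
    Prod.ext ((hG₁ _).trans (map_zero G₀)) rfl
  let φ : g ≃ₗ⁅k⁆ g' :=
    { F₀ with
      map_lie' := fun {x y} => (hF₂' x y).symm.trans (hF₂ x y)
      invFun := G₀
      left_inv := hGF₀
      right_inv := hFG₀ }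
  let ψ : V ≃ₗ[k] V' := LinearEquiv.ofLinearMap
    (LinearMap.snd k g' V' ∘ₗ F₁ ∘ₗ LinearMap.inr k g V)
    (LinearMap.snd k g V ∘ₗ G₁ ∘ₗ LinearMap.inr k g' V')
    (LinearMap.ext fun v => by
      change (F₁ (0, (G₁ (0, v)).2)).2 = v
      rw [← hG₁z, hFG₁])
    (LinearMap.ext fun v => by
      change (G₁ (0, (F₁ (0, v)).2)).2 = v
      rw [← hF₁z, hGF₁])
  have hF : ∀ x v, F₁ (x, v) = (F₀ x, ψ v) := fun x v => by
    have h : ((x, v) : g × V) = (x, 0) + (0, v) := by simp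
    rw [h, map_add, hF₁', hF₁z]
    simp [ψ]
  have hψ : ∀ x v, ψ (ρ x v) = ρ' (φ x) (ψ v) := fun x v => by
    have h : (ρ' (F₁ (x, 0)).1 (F₁ (0, v)).2 - ρ' (F₁ (0, v)).1 (F₁ (x, 0)).2) + (F₂ x 0).2 =
        (F₂ x 0).2 + (F₁ (⁅x, 0⁆, ρ x v - ρ 0 0)).2 :=
      congrArg Prod.snd (F.two_naturality ((x, 0) : g × V) ((0, v) : g × V))
    rw [hF, hF, hF] at h
    simp only [map_zero, sub_zero, Prod.snd_zero, zero_add, add_zero] at h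
    exact h.symm
  refine ⟨φ, ψ, hψ, (H3.map_mk_eq_mk_iff φ ψ hψ ω ω').2
    ⟨alternatingOfSkew₂ hk (fun x y => (F₂ (φ.symm x) (φ.symm y)).2) (fun x x' y => by simp)
      (fun c x y => by simp) (fun x y => by rw [hskew]; rfl), fun x y z => ?_⟩⟩
  -- The coherence law of `F` on the second components.
  have h : (ω'.1 ![φ x, φ y, φ z] + ((ρ' (φ x) (F₂ y z).2 - ρ' (F₂ y z).1 0) +
        (ρ' (F₂ x z).1 0 - ρ' (φ y) (F₂ x z).2))) + ((F₂ x ⁅y, z⁆).2 + (F₂ ⁅x, z⁆ y).2) =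
      ((ρ' (F₂ x y).1 0 - ρ' (φ z) (F₂ x y).2) + (F₂ ⁅x, y⁆ z).2) +
        (F₁ (⁅⁅x, y⁆, z⁆, ω.1 ![x, y, z])).2 :=
    congrArg Prod.snd (F.coherence x y z)
  rw [hF] at h
  have h' := congrArg Prod.snd (hskew x ⁅y, z⁆)
  rw [coboundary_one_apply]
  simp [← LieEquiv.map_lie] at h h' ⊢
  grind

end Skeletal

/-! ### Chain-level identities in a Lie 2-algebra -/

namespace Lie2Alg

variable (L : Lie2Alg.{w, u} k)

/-- The action `v ↦ [1_x, v]` of an object `x` on morphisms. -/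
def act : L.carrier.obj →ₗ[k] L.carrier.mor →ₗ[k] L.carrier.mor :=
  L.bracket.onMor ∘ₗ L.carrier.ident

/-- The arrow part of the Jacobiator. -/
def jarrow (x y z : L.carrier.obj) : L.carrier.mor := L.carrier.arrow (L.jac.app x y z)

lemma onMor_ident_left (x : L.carrier.obj) (v : L.carrier.mor) :
    L.bracket.onMor (L.carrier.ident x) v = L.act x v := rfl

lemma onMor_ident_right (x : L.carrier.obj) (v : L.carrier.mor) :
    L.bracket.onMor v (L.carrier.ident x) = -L.act x v := by
  rw [L.bracket_skew.2, onMor_ident_left]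

@[simp] lemma src_act (x : L.carrier.obj) (v : L.carrier.mor) :
    L.carrier.src (L.act x v) = L.bracket.onObj x (L.carrier.src v) := by
  simp [act]

@[simp] lemma tgt_act (x : L.carrier.obj) (v : L.carrier.mor) :
    L.carrier.tgt (L.act x v) = L.bracket.onObj x (L.carrier.tgt v) := by
  simp [act]

/-- The bracket of a morphism `f` with a morphism `g` out of `0` depends on `f` only through its
target, since it is the composite of `[f, 1_0] = 0` and `[1, g]`. -/
lemma onMor_eq_act (f : L.carrier.mor) {g : L.carrier.mor} (hg : L.carrier.src g = 0) :
    L.bracket.onMor f g = L.act (L.carrier.tgt f) g := by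
  have h := L.bracket.map_cmp f (L.carrier.ident (L.carrier.tgt f)) 0 g (by simp) (by simp [hg])
  simpa [TwoVect.cmp_eq, hg, act] using h

lemma act_tgt {f g : L.carrier.mor} (hf : L.carrier.src f = 0) (hg : L.carrier.src g = 0) :
    L.act (L.carrier.tgt f) g = -L.act (L.carrier.tgt g) f := by
  rw [← L.onMor_eq_act f hg, L.bracket_skew.2, L.onMor_eq_act g hf]

@[simp] lemma src_jarrow (x y z : L.carrier.obj) : L.carrier.src (L.jarrow x y z) = 0 := by
  simp [jarrow, TwoVect.arrow]

@[simp] lemma tgt_jarrow (x y z : L.carrier.obj) : L.carrier.tgt (L.jarrow x y z) =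
    L.bracket.onObj x (L.bracket.onObj y z) + L.bracket.onObj (L.bracket.onObj x z) y -
      L.bracket.onObj (L.bracket.onObj x y) z := by
  simp [jarrow, TwoVect.arrow]

lemma jarrow_swap₁₂ (x y z : L.carrier.obj) : L.jarrow y x z = -L.jarrow x y z :=
  L.jac.arrow_swap₁₂ x y z

lemma jarrow_swap₂₃ (x y z : L.carrier.obj) : L.jarrow x z y = -L.jarrow x y z :=
  L.jac.arrow_swap₂₃ x y z

lemma jarrow_add (x x' y z : L.carrier.obj) :
    L.jarrow (x + x') y z = L.jarrow x y z + L.jarrow x' y z := by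
  simp [jarrow, TwoVect.arrow]
  abel

lemma jarrow_smul (c : k) (x y z : L.carrier.obj) :
    L.jarrow (c • x) y z = c • L.jarrow x y z := by
  simp [jarrow, TwoVect.arrow, smul_sub]

lemma jarrow_sub (x x' y z : L.carrier.obj) :
    L.jarrow (x - x') y z = L.jarrow x y z - L.jarrow x' y z := by
  simp [jarrow, TwoVect.arrow]
  abel

/-- Naturality of the Jacobiator: it is the homotopy by which `act` fails to be a representation
on the morphisms out of `0`. -/
lemma jarrow_tgt {v : L.carrier.mor} (hv : L.carrier.src v = 0) (x y : L.carrier.obj) :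
    L.jarrow (L.carrier.tgt v) x y =
      L.act x (L.act y v) - L.act y (L.act x v) - L.act (L.bracket.onObj x y) v := by
  have h := L.jac.naturality (L.carrier.ident x) (L.carrier.ident y) v
  rw [← neg_neg (L.jarrow _ x y), ← L.jarrow_swap₁₂, ← L.jarrow_swap₂₃]
  simp [TwoVect.cmp_eq, hv, jarrow, TwoVect.arrow, onMor_ident_left, onMor_ident_right] at h ⊢
  grind

/-- The Jacobiator identity on arrow parts. -/
lemma jarrow_identity (w x y z : L.carrier.obj) :
    L.jarrow (L.bracket.onObj w x) y z - L.act y (L.jarrow w x z) +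
        (L.jarrow w (L.bracket.onObj x z) y + L.jarrow (L.bracket.onObj w z) x y +
          L.jarrow w x (L.bracket.onObj y z)) =
      -L.act z (L.jarrow w x y) +
        (L.jarrow (L.bracket.onObj w y) x z + L.jarrow w (L.bracket.onObj x y) z) -
        L.act x (L.jarrow w y z) + L.act w (L.jarrow x y z) := by
  have h := L.jacobiator_identity w x y z
  simp [Jacobiator.leftPath, Jacobiator.rightPath, TwoVect.cmp_eq, jarrow, TwoVect.arrow,
    ← onMor_ident_left] at h ⊢
  have h₁ := L.bracket_skew.2 (L.carrier.ident y) (L.jac.app w x z)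
  have h₂ := L.bracket_skew.2 (L.carrier.ident z) (L.jac.app w x y)
  have h₃ := L.bracket_skew.2 (L.carrier.ident x) (L.jac.app w y z)
  have e₁ := congrArg L.carrier.ident
    (L.bracket_skew.1 y (L.bracket.onObj (L.bracket.onObj w x) z))
  have e₂ := congrArg L.carrier.ident
    (L.bracket_skew.1 z (L.bracket.onObj (L.bracket.onObj w x) y))
  have e₃ := congrArg L.carrier.ident
    (L.bracket_skew.1 x (L.bracket.onObj (L.bracket.onObj w y) z))
  simp only [map_neg] at e₁ e₂ e₃
  grind

end Lie2Alg

/-! ### Splittings of 2-vector spaces -/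

namespace TwoVect

variable (V : TwoVect.{w, u} k)

/-- The space of isomorphism classes of objects: `x` and `y` are isomorphic when `y - x` is the
target of a morphism out of `0`. -/
abbrev IsoClasses : Type u :=
  V.obj ⧸ LinearMap.range (V.tgt ∘ₗ (LinearMap.ker V.src).subtype)

/-- The space of endomorphisms of the object `0`. -/
abbrev EndZero : Type u := ↥(LinearMap.ker V.src ⊓ LinearMap.ker V.tgt)

/-- A skeleton of a 2-vector space: a linear choice `s` of representatives of the isomorphism
classes, together with a morphism `h x : 0 ⟶ x - s [x]` for each object `x`, linear in `x`. -/
structure Splitting where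
  s : V.IsoClasses →ₗ[k] V.obj
  h : V.obj →ₗ[k] V.mor
  mk_s : ∀ a, Submodule.Quotient.mk (s a) = a
  src_h : ∀ x, V.src (h x) = 0
  tgt_h : ∀ x, V.tgt (h x) = x - s (Submodule.Quotient.mk x)

attribute [simp] Splitting.mk_s Splitting.src_h Splitting.tgt_h

lemma mk_src_eq_mk_tgt (f : V.mor) :
    (Submodule.Quotient.mk (V.src f) : V.IsoClasses) = Submodule.Quotient.mk (V.tgt f) := by
  have h : V.src (f - V.ident (V.src f)) = 0 := by simp
  rw [eq_comm, Submodule.Quotient.eq]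
  exact ⟨⟨_, h⟩, by simp⟩

/-- Every 2-vector space over a field has a skeleton. -/
lemma nonempty_splitting : Nonempty V.Splitting := by
  let d := V.tgt ∘ₗ (LinearMap.ker V.src).subtype
  obtain ⟨s, hs⟩ := (LinearMap.range d).mkQ.exists_rightInverse_of_surjective
    (Submodule.range_mkQ _)
  obtain ⟨σ, hσ⟩ := d.rangeRestrict.exists_rightInverse_of_surjective d.range_rangeRestrict
  have hs' : ∀ a, (Submodule.Quotient.mk (s a) : V.IsoClasses) = a := LinearMap.congr_fun hs
  let p : V.obj →ₗ[k] LinearMap.range d :=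
    (LinearMap.id - s ∘ₗ (LinearMap.range d).mkQ).codRestrict _ fun x => by
      rw [← Submodule.Quotient.mk_eq_zero, LinearMap.sub_apply, Submodule.Quotient.mk_sub]
      exact sub_eq_zero.2 (hs' _).symm
  exact ⟨s, (LinearMap.ker V.src).subtype ∘ₗ σ ∘ₗ p, hs', fun x => (σ (p x)).2,
    fun x => congrArg Subtype.val (LinearMap.congr_fun hσ (p x))⟩

end TwoVect

/-! ### The cocycle of a Lie 2-algebra -/

namespace TwoVect.Splitting

open Lie2Alg

variable {L : Lie2Alg.{w, u} k} (C : L.carrier.Splitting)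

/-- The bracket induced on isomorphism classes. -/
def br : L.carrier.IsoClasses →ₗ[k] L.carrier.IsoClasses →ₗ[k] L.carrier.IsoClasses :=
  (L.bracket.onObj.compl₁₂ C.s C.s).compr₂ (Submodule.mkQ _)

lemma br_apply (a b : L.carrier.IsoClasses) :
    C.br a b = Submodule.Quotient.mk (L.bracket.onObj (C.s a) (C.s b)) := rfl

/-- The arrow part of a morphism `s [a, b] ⟶ [s a, s b]`. -/
def defect : L.carrier.IsoClasses →ₗ[k] L.carrier.IsoClasses →ₗ[k] L.carrier.mor :=
  (L.bracket.onObj.compl₁₂ C.s C.s).compr₂ C.h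

@[simp] lemma src_defect (a b : L.carrier.IsoClasses) : L.carrier.src (C.defect a b) = 0 :=
  C.src_h _

lemma s_br (a b : L.carrier.IsoClasses) :
    C.s (C.br a b) = L.bracket.onObj (C.s a) (C.s b) - L.carrier.tgt (C.defect a b) := by
  simp [defect, br_apply]

@[simp] lemma tgt_defect (a b : L.carrier.IsoClasses) :
    L.carrier.tgt (C.defect a b) = L.bracket.onObj (C.s a) (C.s b) - C.s (C.br a b) := by
  simp [s_br]

lemma br_skew (a b : L.carrier.IsoClasses) : C.br a b = -C.br b a := by
  rw [br_apply, L.bracket_skew.1]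
  rfl

lemma defect_skew (a b : L.carrier.IsoClasses) : C.defect a b = -C.defect b a := by
  simp only [defect, LinearMap.compr₂_apply, LinearMap.compl₁₂_apply]
  rw [L.bracket_skew.1, map_neg]

lemma br_br (a b c : L.carrier.IsoClasses) : C.br (C.br a b) c =
    Submodule.Quotient.mk (L.bracket.onObj (L.bracket.onObj (C.s a) (C.s b)) (C.s c)) := by
  have h := L.carrier.mk_src_eq_mk_tgt (L.act (C.s c) (C.defect a b))
  rw [src_act, tgt_act, src_defect, map_zero, tgt_defect, map_sub, L.bracket_skew.1,
    L.bracket_skew.1 (C.s c), sub_neg_eq_add, neg_add_eq_sub, Submodule.Quotient.mk_sub,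
    Submodule.Quotient.mk_zero, eq_comm, sub_eq_zero] at h
  exact h

/-- The Jacobi identity on isomorphism classes. -/
lemma br_jacobi (a b c : L.carrier.IsoClasses) :
    C.br (C.br a b) c = C.br a (C.br b c) + C.br (C.br a c) b := by
  have h := L.carrier.mk_src_eq_mk_tgt (L.jac.app (C.s a) (C.s b) (C.s c))
  rw [C.br_skew a (C.br b c), br_br, br_br, br_br, ← Submodule.Quotient.mk_neg, ← L.bracket_skew.1,
    ← Submodule.Quotient.mk_add]
  simpa using h

/-- The Jacobiator transported to the skeleton: the Jacobiator of `L` on representatives, corrected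
by the defect so that the coherence law of the inclusion of the skeleton holds. -/
def jacobiator (a b c : L.carrier.IsoClasses) : L.carrier.mor :=
  L.jarrow (C.s a) (C.s b) (C.s c) - L.act (C.s a) (C.defect b c) +
    L.act (C.s b) (C.defect a c) - L.act (C.s c) (C.defect a b) -
    C.defect a (C.br b c) - C.defect (C.br a c) b + C.defect (C.br a b) c

lemma src_jacobiator (a b c : L.carrier.IsoClasses) :
    L.carrier.src (C.jacobiator a b c) = 0 := by
  simp [jacobiator]

lemma tgt_jacobiator (a b c : L.carrier.IsoClasses) :
    L.carrier.tgt (C.jacobiator a b c) = 0 := by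
  have h := congrArg C.s (C.br_jacobi a b c)
  have h₁ := L.bracket_skew.1 (C.s b) (L.bracket.onObj (C.s a) (C.s c))
  have h₂ := L.bracket_skew.1 (C.s c) (L.bracket.onObj (C.s a) (C.s b))
  have h₃ := L.bracket_skew.1 (C.s b) (C.s (C.br a c))
  have h₄ := L.bracket_skew.1 (C.s c) (C.s (C.br a b))
  simp [jacobiator] at h ⊢
  grind

lemma jacobiator_swap₁₂ (a b c : L.carrier.IsoClasses) :
    C.jacobiator b a c = -C.jacobiator a b c := by
  simp only [jacobiator]
  rw [L.jarrow_swap₁₂, C.defect_skew b a, C.br_skew b a,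
    C.defect_skew b (C.br a c), C.defect_skew a (C.br b c)]
  simp only [map_neg, LinearMap.neg_apply]
  abel

lemma jacobiator_swap₂₃ (a b c : L.carrier.IsoClasses) :
    C.jacobiator a c b = -C.jacobiator a b c := by
  simp only [jacobiator]
  rw [L.jarrow_swap₂₃, C.defect_skew c b, C.br_skew c b]
  simp only [map_neg]
  abel

lemma jacobiator_add (a a' b c : L.carrier.IsoClasses) :
    C.jacobiator (a + a') b c = C.jacobiator a b c + C.jacobiator a' b c := by
  simp only [jacobiator, map_add, LinearMap.add_apply, L.jarrow_add]
  abel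

lemma jacobiator_smul (r : k) (a b c : L.carrier.IsoClasses) :
    C.jacobiator (r • a) b c = r • C.jacobiator a b c := by
  simp only [jacobiator, map_smul, LinearMap.smul_apply, L.jarrow_smul, smul_sub, smul_add]

/-- The cocycle law of the transported Jacobiator. The terms of the Jacobiator identity for the
representatives remain up to the defect of `s`; by `jarrow_tgt`, the Jacobiators of the targets of
the defect compensate for the failure of `act` to be a representation. -/
lemma jacobiator_cocycle (a b c d : L.carrier.IsoClasses) :
    L.act (C.s a) (C.jacobiator b c d) - L.act (C.s b) (C.jacobiator a c d) +
      L.act (C.s c) (C.jacobiator a b d) - L.act (C.s d) (C.jacobiator a b c) -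
      C.jacobiator (C.br a b) c d + C.jacobiator (C.br a c) b d -
      C.jacobiator (C.br a d) b c - C.jacobiator (C.br b c) a d +
      C.jacobiator (C.br b d) a c - C.jacobiator (C.br c d) a b = 0 := by
  have hJ := L.jarrow_identity (C.s a) (C.s b) (C.s c) (C.s d)
  have s₁ := L.jarrow_swap₁₂ (L.bracket.onObj (C.s b) (C.s d)) (C.s a) (C.s c)
  have s₂ := L.jarrow_swap₁₂ (L.bracket.onObj (C.s b) (C.s c)) (C.s a) (C.s d)
  have s₃ := L.jarrow_swap₂₃ (C.s a) (L.bracket.onObj (C.s c) (C.s d)) (C.s b)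
  have s₄ := L.jarrow_swap₁₂ (L.bracket.onObj (C.s c) (C.s d)) (C.s a) (C.s b)
  have j₁ := L.jarrow_tgt (C.src_defect a b) (C.s c) (C.s d)
  have j₂ := L.jarrow_tgt (C.src_defect a c) (C.s b) (C.s d)
  have j₃ := L.jarrow_tgt (C.src_defect a d) (C.s b) (C.s c)
  have j₄ := L.jarrow_tgt (C.src_defect b c) (C.s a) (C.s d)
  have j₅ := L.jarrow_tgt (C.src_defect b d) (C.s a) (C.s c)
  have j₆ := L.jarrow_tgt (C.src_defect c d) (C.s a) (C.s b)
  have t₁ := L.act_tgt (C.src_defect a b) (C.src_defect c d)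
  have t₂ := L.act_tgt (C.src_defect a c) (C.src_defect b d)
  have t₃ := L.act_tgt (C.src_defect a d) (C.src_defect b c)
  have d₁ := C.defect_skew (C.br a b) (C.br c d)
  have d₂ := C.defect_skew (C.br a c) (C.br b d)
  have d₃ := C.defect_skew (C.br a d) (C.br b c)
  have e₁ := congrArg (fun x => C.defect x d) (C.br_jacobi a b c)
  have e₂ := congrArg (fun x => C.defect x c) (C.br_jacobi a b d)
  have e₃ := congrArg (fun x => C.defect x b) (C.br_jacobi a c d)
  have e₄ := congrArg (fun x => C.defect x a) (C.br_jacobi b c d)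
  rw [C.br_skew a (C.br b c)] at e₁
  rw [C.br_skew a (C.br b d)] at e₂
  rw [C.br_skew a (C.br c d)] at e₃
  rw [C.br_skew b (C.br c d)] at e₄
  simp only [map_add, map_neg, LinearMap.add_apply, LinearMap.neg_apply] at e₁ e₂ e₃ e₄
  have f₁ := C.defect_skew b (C.br c d)
  have f₂ := C.defect_skew a (C.br c d)
  have f₃ := C.defect_skew a (C.br b d)
  have f₄ := C.defect_skew a (C.br b c)
  simp only [jacobiator, s_br, L.jarrow_sub, j₁, j₂, j₃, j₄, j₅, j₆, f₁, f₂, f₃, f₄, map_add,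
    map_sub, map_neg, LinearMap.sub_apply]
  clear j₁ j₂ j₃ j₄ j₅ j₆ f₁ f₂ f₃ f₄
  grind

end TwoVect.Splitting

/-! ### Every Lie 2-algebra is equivalent to a skeletal one -/

namespace TwoVect.Splitting

open Lie2Alg

variable {L : Lie2Alg.{w, u} k} (C : L.carrier.Splitting)

/-- The Lie ring structure on isomorphism classes of objects. -/
abbrev lieRing (hk : ringChar k ≠ 2) : LieRing L.carrier.IsoClasses where
  bracket a b := C.br a b
  add_lie _ _ _ := LinearMap.map_add₂ _ _ _ _
  lie_add _ _ _ := map_add _ _ _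
  lie_self a := eq_zero_of_eq_neg_of_ringChar hk (C.br_skew a a)
  leibniz_lie a b c := by
    change C.br a (C.br b c) = C.br (C.br a b) c + C.br b (C.br a c)
    rw [C.br_jacobi a b c, C.br_skew b (C.br a c)]
    abel

/-- The Lie algebra structure over `k` on isomorphism classes of objects. -/
abbrev lieAlgebra (hk : ringChar k ≠ 2) :
    letI := C.lieRing hk
    LieAlgebra k L.carrier.IsoClasses :=
  letI := C.lieRing hk
  { lie_smul := fun _ _ _ => map_smul _ _ _ }

@[simp] lemma src_coe_endZero (v : L.carrier.EndZero) : L.carrier.src v = 0 := v.2.1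

@[simp] lemma tgt_coe_endZero (v : L.carrier.EndZero) : L.carrier.tgt v = 0 := v.2.2

/-- The action of an object on the endomorphisms of `0`. -/
def actEnd (x : L.carrier.obj) : Module.End k L.carrier.EndZero :=
  (L.act x ∘ₗ Submodule.subtype _).codRestrict _ fun v => by
    simp [Submodule.mem_inf, LinearMap.mem_ker]

@[simp] lemma coe_actEnd (x : L.carrier.obj) (v : L.carrier.EndZero) :
    (actEnd x v : L.carrier.mor) = L.act x v := rfl

attribute [local instance] LieRing.ofAssociativeRing in
/-- The representation of the isomorphism classes of objects on the endomorphisms of `0`. -/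
def rep (hk : ringChar k ≠ 2) :
    letI := C.lieRing hk
    letI := C.lieAlgebra hk
    LieRep k L.carrier.IsoClasses L.carrier.EndZero :=
  letI := C.lieRing hk
  letI := C.lieAlgebra hk
  { toFun := fun a => actEnd (C.s a)
    map_add' := fun a b => LinearMap.ext fun v => Subtype.ext (by simp)
    map_smul' := fun c a => LinearMap.ext fun v => Subtype.ext (by simp)
    map_lie' := fun {a b} => LinearMap.ext fun v => Subtype.ext (by
      have hs : L.carrier.src v = 0 := src_coe_endZero v
      have ht : L.carrier.tgt v = 0 := tgt_coe_endZero v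
      have h₁ := L.jarrow_tgt hs (C.s a) (C.s b)
      have h₂ := L.act_tgt (C.src_defect a b) hs
      have h₃ : L.jarrow 0 (C.s a) (C.s b) = 0 := by
        simpa using L.jarrow_sub 0 0 (C.s a) (C.s b)
      change L.act (C.s (C.br a b)) v =
        L.act (C.s a) (L.act (C.s b) v) - L.act (C.s b) (L.act (C.s a) v)
      rw [ht, map_zero, LinearMap.zero_apply, neg_zero] at h₂
      rw [ht, h₃] at h₁
      rw [s_br, map_sub, LinearMap.sub_apply, h₂, sub_zero]
      exact (sub_eq_zero.1 h₁.symm).symm) }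

/-- The 3-cocycle of a Lie 2-algebra: the transported Jacobiator, whose values have source and
target `0`. -/
def cocycle (hk : ringChar k ≠ 2) :
    letI := C.lieRing hk
    letI := C.lieAlgebra hk
    Z3 (C.rep hk) :=
  letI := C.lieRing hk
  letI := C.lieAlgebra hk
  ⟨alternatingOfSkew₃ hk
    (fun a b c => ⟨C.jacobiator a b c, C.src_jacobiator a b c, C.tgt_jacobiator a b c⟩)
    (fun a a' b c => Subtype.ext (C.jacobiator_add a a' b c))
    (fun r a b c => Subtype.ext (C.jacobiator_smul r a b c))
    (fun a b c => Subtype.ext (C.jacobiator_swap₁₂ a b c))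
    (fun a b c => Subtype.ext (C.jacobiator_swap₂₃ a b c)), by
    change coboundary _ 2 _ = 0
    funext v
    have hv : v = ![v 0, v 1, v 2, v 3] := by
      ext i
      fin_cases i <;> rfl
    rw [hv, coboundary_two_apply]
    exact Subtype.ext (C.jacobiator_cocycle (v 0) (v 1) (v 2) (v 3))⟩

/-- The morphism `s a ⟶ s a` with arrow part `v`. -/
def loop : L.carrier.IsoClasses × L.carrier.EndZero →ₗ[k] L.carrier.mor :=
  (L.carrier.ident ∘ₗ C.s).coprod (Submodule.subtype _)

lemma loop_apply (f : L.carrier.IsoClasses × L.carrier.EndZero) :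
    C.loop f = L.carrier.ident (C.s f.1) + f.2 := rfl

/-- The morphism `[s a, s b] ⟶ s [a, b]` given by the inverse of the defect. -/
def comparison : L.carrier.IsoClasses →ₗ[k] L.carrier.IsoClasses →ₗ[k] L.carrier.mor :=
  (L.bracket.onObj.compl₁₂ C.s C.s).compr₂ L.carrier.ident - C.defect

lemma comparison_apply (a b : L.carrier.IsoClasses) : C.comparison a b =
    L.carrier.ident (L.bracket.onObj (C.s a) (C.s b)) - C.defect a b := rfl

/-- The inclusion of the skeleton, without its coherence law. -/
def preInclusion (hk : ringChar k ≠ 2) :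
    letI := C.lieRing hk
    letI := C.lieAlgebra hk
    PreHom (skeletalLie2Alg (C.rep hk) (C.cocycle hk)) L :=
  letI := C.lieRing hk
  letI := C.lieAlgebra hk
  { onObj := C.s
    onMor := C.loop
    src_map := fun (f : L.carrier.IsoClasses × L.carrier.EndZero) => by
      change L.carrier.src (C.loop f) = C.s f.1
      simp [loop_apply]
    tgt_map := fun (f : L.carrier.IsoClasses × L.carrier.EndZero) => by
      change L.carrier.tgt (C.loop f) = C.s f.1
      simp [loop_apply]
    map_ident := fun (a : L.carrier.IsoClasses) => by
      change C.loop (a, 0) = L.carrier.ident (C.s a)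
      simp [loop_apply]
    map_cmp := by
      intro (⟨a, v⟩ : L.carrier.IsoClasses × L.carrier.EndZero)
        (⟨b, w⟩ : L.carrier.IsoClasses × L.carrier.EndZero) h
      obtain rfl : a = b := h
      rw [TwoVect.cmp_eq]
      change C.loop (a, v + w) = C.loop (a, v) + C.loop (a, w) -
        L.carrier.ident (L.carrier.src (C.loop (a, w)))
      simp [loop_apply]
      abel
    two := C.comparison
    src_two := fun (a b : L.carrier.IsoClasses) => by
      change L.carrier.src (C.comparison a b) = L.bracket.onObj (C.s a) (C.s b)
      simp [comparison_apply]
    tgt_two := fun (a b : L.carrier.IsoClasses) => by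
      change L.carrier.tgt (C.comparison a b) = C.s (C.br a b)
      simp [comparison_apply]
    two_naturality := by
      intro (⟨a, v⟩ : L.carrier.IsoClasses × L.carrier.EndZero)
        (⟨b, w⟩ : L.carrier.IsoClasses × L.carrier.EndZero)
      rw [TwoVect.cmp_eq, TwoVect.cmp_eq]
      change L.bracket.onMor (C.loop (a, v)) (C.loop (b, w)) + C.comparison a b -
          L.carrier.ident (L.carrier.src (C.comparison a b)) =
        C.comparison a b + C.loop (C.br a b, actEnd (C.s a) w - actEnd (C.s b) v) -
          L.carrier.ident (L.carrier.src
            (C.loop (C.br a b, actEnd (C.s a) w - actEnd (C.s b) v)))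
      have h := L.onMor_eq_act (v : L.carrier.mor) (src_coe_endZero w)
      rw [tgt_coe_endZero, map_zero, LinearMap.zero_apply] at h
      simp [loop_apply, comparison_apply, h, onMor_ident_right]
      simp [onMor_ident_left]
      abel
    two_skew := fun (a b : L.carrier.IsoClasses) => by
      change C.comparison a b = -C.comparison b a
      rw [comparison_apply, comparison_apply, C.defect_skew a b, L.bracket_skew.1 (C.s a), map_neg]
      abel }

/-- The inclusion of the skeleton. Its coherence law is the definition of the transported
Jacobiator. -/
def inclusion (hk : ringChar k ≠ 2) :
    letI := C.lieRing hk
    letI := C.lieAlgebra hk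
    Hom (skeletalLie2Alg (C.rep hk) (C.cocycle hk)) L :=
  letI := C.lieRing hk
  letI := C.lieAlgebra hk
  { C.preInclusion hk with
    coherence := fun (a b c : L.carrier.IsoClasses) => by
      simp only [PreHom.upperPath, PreHom.lowerPath, TwoVect.cmp_eq]
      change L.jac.app (C.s a) (C.s b) (C.s c) +
          (L.bracket.onMor (L.carrier.ident (C.s a)) (C.comparison b c) +
            L.bracket.onMor (C.comparison a c) (L.carrier.ident (C.s b))) -
          L.carrier.ident (L.carrier.src
            (L.bracket.onMor (L.carrier.ident (C.s a)) (C.comparison b c) +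
              L.bracket.onMor (C.comparison a c) (L.carrier.ident (C.s b)))) +
          (C.comparison a (C.br b c) + C.comparison (C.br a c) b) -
          L.carrier.ident (L.carrier.src
            (C.comparison a (C.br b c) + C.comparison (C.br a c) b)) =
        L.bracket.onMor (C.comparison a b) (L.carrier.ident (C.s c)) +
          C.comparison (C.br a b) c - L.carrier.ident (L.carrier.src (C.comparison (C.br a b) c)) +
          C.loop (C.br (C.br a b) c,
            ⟨C.jacobiator a b c, C.src_jacobiator a b c, C.tgt_jacobiator a b c⟩) -
          L.carrier.ident (L.carrier.src (C.loop (C.br (C.br a b) c,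
            ⟨C.jacobiator a b c, C.src_jacobiator a b c, C.tgt_jacobiator a b c⟩)))
      simp [comparison_apply, loop_apply, jacobiator, jarrow, TwoVect.arrow, onMor_ident_right]
      simp [onMor_ident_left]
      abel }

end TwoVect.Splitting

namespace Lie2Alg

/-- Every Lie 2-algebra is equivalent to a skeletal one. -/
theorem exists_skeletalLie2Alg_objEquiv (hk : ringChar k ≠ 2) (L : Lie2Alg.{w, u} k) :
    ∃ (Q : Quadruple.{w, u} k) (ω : Z3 Q.ρ),
      H3.mk Q.ρ ω = Q.cls ∧ ObjEquiv (skeletalLie2Alg Q.ρ ω) L := by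
  obtain ⟨C⟩ := L.carrier.nonempty_splitting
  let _ := C.lieRing hk
  let _ := C.lieAlgebra hk
  refine ⟨⟨_, _, C.rep hk, H3.mk _ (C.cocycle hk)⟩, C.cocycle hk, rfl,
    objEquiv_of_isFullyFaithful (C.inclusion hk) ⟨?_, ?_⟩ ?_⟩
  · intro (⟨a, v⟩ : L.carrier.IsoClasses × L.carrier.EndZero)
      (⟨b, w⟩ : L.carrier.IsoClasses × L.carrier.EndZero) (h : a = b) _ hvw
    replace hvw : L.carrier.ident (C.s a) + (v : L.carrier.mor) =
      L.carrier.ident (C.s b) + (w : L.carrier.mor) := hvw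
    rw [h] at hvw
    exact Prod.ext h (Subtype.ext (add_left_cancel hvw))
  · intro (a : L.carrier.IsoClasses) (b : L.carrier.IsoClasses) m hs ht
    replace hs : L.carrier.src m = C.s a := hs
    replace ht : L.carrier.tgt m = C.s b := ht
    have hab : a = b := by
      have h := L.carrier.mk_src_eq_mk_tgt m
      rwa [hs, ht, C.mk_s, C.mk_s] at h
    have hm : m - L.carrier.ident (C.s a) ∈
        LinearMap.ker L.carrier.src ⊓ LinearMap.ker L.carrier.tgt := by
      simp [Submodule.mem_inf, hs, ht, hab]
    exact ⟨((a, ⟨_, hm⟩) : L.carrier.IsoClasses × L.carrier.EndZero), rfl, hab,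
      add_sub_cancel (L.carrier.ident (C.s a)) m⟩
  · intro X
    refine ⟨(Submodule.Quotient.mk X : L.carrier.IsoClasses),
      L.carrier.ident (C.s (Submodule.Quotient.mk X)) + C.h X, ?_, ?_⟩
    · change _ = C.s (Submodule.Quotient.mk X)
      simp
    · simp

end Lie2Alg

/-! ### The bijection -/

/-- The class of the skeletal Lie 2-algebra of a quadruple, for a cocycle chosen to represent the
cohomology class. -/
noncomputable def skeletalClass (k : Type w) [Field k] :
    Quotient (Quadruple.isoSetoid.{w, u} k) → Quotient (Lie2Alg.equivSetoid.{w, u} k) :=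
  Quotient.lift (fun Q => Quotient.mk _
      (skeletalLie2Alg Q.ρ (Submodule.Quotient.mk_surjective _ Q.cls).choose)) (by
    rintro Q Q' ⟨⟨φ, ψ, h, hc⟩⟩
    refine Quotient.sound (objEquiv_skeletalLie2Alg φ ψ h _ _ ?_)
    have e := (Submodule.Quotient.mk_surjective _ Q.cls).choose_spec
    have e' := (Submodule.Quotient.mk_surjective _ Q'.cls).choose_spec
    change H3.map φ ψ h (Submodule.Quotient.mk _) = Submodule.Quotient.mk _
    rw [e, e', hc])

/-- The class of the skeletal Lie 2-algebra does not depend on the chosen cocycle. -/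
lemma skeletalClass_mk (Q : Quadruple.{w, u} k) (ω : Z3 Q.ρ) (h : H3.mk Q.ρ ω = Q.cls) :
    skeletalClass k (Quotient.mk _ Q) = Quotient.mk _ (skeletalLie2Alg Q.ρ ω) := by
  refine Quotient.sound (objEquiv_skeletalLie2Alg LieEquiv.refl (LinearEquiv.refl k Q.V)
    (fun _ _ => rfl) _ _ ?_)
  have e := (Submodule.Quotient.mk_surjective _ Q.cls).choose_spec
  change H3.map _ _ _ (Submodule.Quotient.mk _) = _
  rw [e, ← h]
  exact H3.map_mk _ _ _ ω ω fun _ => rfl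

lemma skeletalClass_bijective (hk : ringChar k ≠ 2) :
    Function.Bijective (skeletalClass.{w, u} k) := by
  constructor
  · rintro ⟨Q⟩ ⟨Q'⟩ h
    obtain ⟨ω, hω⟩ := Submodule.Quotient.mk_surjective _ Q.cls
    obtain ⟨ω', hω'⟩ := Submodule.Quotient.mk_surjective _ Q'.cls
    have h' : Quotient.mk (Lie2Alg.equivSetoid k) (skeletalLie2Alg Q.ρ ω) =
        Quotient.mk _ (skeletalLie2Alg Q'.ρ ω') :=
      (skeletalClass_mk Q ω hω).symm.trans (h.trans (skeletalClass_mk Q' ω' hω'))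
    obtain ⟨φ, ψ, e, hc⟩ := exists_iso_of_objEquiv hk ω ω' (Quotient.exact h')
    refine Quotient.sound ⟨⟨φ, ψ, e, ?_⟩⟩
    rw [← hω, ← hω']
    exact hc
  · rintro ⟨L⟩
    obtain ⟨Q, ω, hω, e⟩ := Lie2Alg.exists_skeletalLie2Alg_objEquiv hk L
    exact ⟨Quotient.mk _ Q, (skeletalClass_mk Q ω hω).trans (Quotient.sound e)⟩

end LieTwo

theorem mainTheorem3 (k : Type w) [Field k] (hk : ringChar k ≠ 2) :
    ∃ Φ : Quotient (LieTwo.Lie2Alg.equivSetoid.{w, u} k) ≃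
        Quotient (LieTwo.Quadruple.isoSetoid.{w, u} k),
      ∀ (g V : Type u) [LieRing g] [LieAlgebra k g] [AddCommGroup V] [Module k V]
        (ρ : LieTwo.LieRep k g V) (ω : LieTwo.Z3 ρ),
        Φ (Quotient.mk (LieTwo.Lie2Alg.equivSetoid k) (LieTwo.skeletalLie2Alg ρ ω)) =
          Quotient.mk (LieTwo.Quadruple.isoSetoid k)
            (LieTwo.Quadruple.mk g V ρ (LieTwo.H3.mk ρ ω)) := by
  refine ⟨(Equiv.ofBijective _ (LieTwo.skeletalClass_bijective hk)).symm, ?_⟩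
  intro g V _ _ _ _ ρ ω
  rw [Equiv.symm_apply_eq]
  exact (LieTwo.skeletalClass_mk (LieTwo.Quadruple.mk g V ρ (LieTwo.H3.mk ρ ω)) ω rfl).symm
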